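/- **Setting.** Let $\mathbb A$ (actions) and $\Theta$ (parameters) be nonempty compact subsets of Euclidean spaces and $\mathbb Y$ (consequences) a Borel subset of a Euclidean space. Let $Q(\cdot\mid a)$, $a\in\mathbb A$, be the true consequence kernel, $Q_\theta(\cdot\mid a)$, $\theta\in\Theta$, $a\in\mathbb A$, the kernels of the agent's (possibly misspecified) model, and $\pi:\mathbb A\times\mathbb Y\to\mathbb R$ the per-period payoff. Assume: * There is a $\sigma$-finite Borel measure $\nu$ on $\mathbb Y$ such that $Q(\cdot\mid a)$ and $Q_\theta(\cdot\mid a)$ have (jointly measurable) densities $q(\cdot\mid a)$ and $q_\theta(\cdot\mid a)$ with respect to $\nu$ for all $(\theta,a)$; for $\nu$-a.e. $y$ the maps $a\mapsto q(y\mid a)$ and $(\theta,a)\mapsto q_\theta(y\mid a)$ are continuous. * There are measurable $M:\mathbb Y\to[1,\infty)$ and $r:\mathbb Y\to[0,\infty)$ with $\int M r\,d\nu<\infty$ such that, for all $(\theta,a)$ and $\nu$-a.e. $y$, $q_\theta(y\mid a)M(y)^{-1}\le q(y\mid a)\le q_\theta(y\mid a)M(y)$ and $q(y\mid a)\le r(y)$.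 * For every $a$ the function $\pi(a,\cdot)$ is $\nu$-measurable, for $\nu$-a.e. $y$ the map $a\mapsto\pi(a,y)$ is continuous, and there is a measurable $h_\pi:\mathbb Y\to[0,\infty)$ with $\int h_\pi M r\,d\nu<\infty$ such that, for all $a$ and $\nu$-a.e. $y$, $|\pi(a,y)|\le h_\pi(y)$. Write $\Delta X$ for the set of Borel probability measures on $X$. For $a\in\mathbb A$, $\theta\in\Theta$, $\mu\in\Delta\Theta$, $\sigma\in\Delta\mathbb A$ put $$U(a,\theta)=\int\pi(a,y)\,Q_\theta(dy\mid a),\qquad F(\mu)=\arg\max_{a\in\mathbb A}\int_\Theta U(a,\theta)\,\mu(d\theta),$$ $$K(\theta,a)=\int\log\frac{q(y\mid a)}{q_\theta(y\mid a)}\,q(y\mid a)\,\nu(dy),\qquad \Theta^{\mathrm m}(\sigma)=\arg\min_{\theta\in\Theta}\int_{\mathbb A}K(\theta,a)\,\sigma(da).$$ A measure $\sigma\in\Delta\mathbb A$ is a *Berk–Nash equilibrium* if there is $\mu\in\Delta\Theta$ with $\operatorname{supp}(\sigma)\subseteq F(\mu)$ and $\operatorname{supp}(\mu)\subseteq\Theta^{\mathrm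 m}(\sigma)$. **Dynamics.** Let $\mu_0\in\Delta\Theta$ have full support, and for each period $t=0,1,2,\ldots$ let $\phi_t$ be a measurable selection rule, that is, a Markov kernel from $\Delta\Theta$ to $\mathbb A$ with $\phi_t(F(\mu)\mid\mu)=1$ for all $\mu$. In period $t$, given the past and the current belief $\mu_t$, the action $a_t$ is drawn from $\phi_t(\cdot\mid\mu_t)$, then the consequence $y_t$ from $Q(\cdot\mid a_t)$, and the belief is updated by Bayes' rule, $$\mu_{t+1}(B)=\frac{\int_B q_\theta(y_t\mid a_t)\,\mu_t(d\theta)}{\int_\Theta q_\theta(y_t\mid a_t)\,\mu_t(d\theta)},\qquad B\subseteq\Theta\text{ Borel}.$$ Let $\mathbf P$ be the probability measure that $\mu_0$, $(\phi_t)$ and $Q$ induce on the infinite sequences $(a_t,y_t)_{t\ge0}$. **Proposition.** $\mathbf P$-almost surely, the following holds for every $a^\star\in\mathbb A$: if $a_t\to a^\star$, then $\delta_{a^\star}$ is a Berk–Nash equilibrium; that is, there exists $\mu^\star\in\Delta\Theta$ with $\operatorname{supp}(\mu^\star)\subseteq\Theta^{\mathrm m}(\delta_{a^\star})$ and $a^\star\in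 F(\mu^\star)$. -/

import Mathlib

open MeasureTheory ProbabilityTheory Filter
open scoped NNReal ENNReal Topology

namespace BerkNash

/-- A single-agent decision problem with a parametric model, together with its standing regularity
assumptions: `A` is the set of actions, `Θ` the set of parameters, `Y` the set of consequences. -/
structure DecisionProblem (A Θ Y : Type*) [TopologicalSpace A] [MeasurableSpace A]
    [TopologicalSpace Θ] [MeasurableSpace Θ] [MeasurableSpace Y] where
  /-- the true consequence kernel `Q(· | a)` -/
  Q : Kernel A Y
  isMarkov_Q : IsMarkovKernel Q
  /-- the model kernels `Q_θ(· | a)` -/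
  Qm : Θ → Kernel A Y
  isMarkov_Qm : ∀ θ, IsMarkovKernel (Qm θ)
  /-- the per-period payoff -/
  payoff : A → Y → ℝ
  /-- the dominating measure -/
  ν : Measure Y
  sigmaFinite_ν : SigmaFinite ν
  /-- the true densities `q(y | a)` -/
  q : A → Y → ℝ≥0
  /-- the model densities `q_θ(y | a)` -/
  qm : Θ → A → Y → ℝ≥0
  measurable_q : Measurable fun p : A × Y => q p.1 p.2
  measurable_qm : Measurable fun p : Θ × A × Y => qm p.1 p.2.1 p.2.2
  Q_eq : ∀ a, Q a = ν.withDensity fun y => (q a y : ℝ≥0∞)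
  Qm_eq : ∀ θ a, Qm θ a = ν.withDensity fun y => (qm θ a y : ℝ≥0∞)
  continuous_q : ∀ᵐ y ∂ν, Continuous fun a => q a y
  continuous_qm : ∀ᵐ y ∂ν, Continuous fun p : Θ × A => qm p.1 p.2 y
  /-- the envelope of the likelihood ratios -/
  M : Y → ℝ≥0
  /-- the envelope of the true densities -/
  r : Y → ℝ≥0
  measurable_M : Measurable M
  measurable_r : Measurable r
  one_le_M : ∀ y, 1 ≤ M y
  ratio_lower : ∀ θ a, ∀ᵐ y ∂ν, qm θ a y * (M y)⁻¹ ≤ q a y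
  ratio_upper : ∀ θ a, ∀ᵐ y ∂ν, q a y ≤ qm θ a y * M y
  q_le_r : ∀ a, ∀ᵐ y ∂ν, q a y ≤ r y
  lintegral_M_r : ∫⁻ y, (M y : ℝ≥0∞) * r y ∂ν < ∞
  aestronglyMeasurable_payoff : ∀ a, AEStronglyMeasurable (payoff a) ν
  continuous_payoff : ∀ᵐ y ∂ν, Continuous fun a => payoff a y
  /-- the envelope of the payoff -/
  hπ : Y → ℝ≥0
  measurable_hπ : Measurable hπ
  abs_payoff_le : ∀ a, ∀ᵐ y ∂ν, |payoff a y| ≤ hπ y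
  lintegral_hπ_M_r : ∫⁻ y, (hπ y : ℝ≥0∞) * M y * r y ∂ν < ∞

attribute [instance] DecisionProblem.isMarkov_Q DecisionProblem.isMarkov_Qm
  DecisionProblem.sigmaFinite_ν

namespace DecisionProblem

variable {A Θ Y : Type*} [TopologicalSpace A] [MeasurableSpace A]
  [TopologicalSpace Θ] [MeasurableSpace Θ] [MeasurableSpace Y]

/-- Expected payoff `U(a, θ)` of the action `a` under the parameter `θ`. -/
noncomputable def U (D : DecisionProblem A Θ Y) (a : A) (θ : Θ) : ℝ :=
  ∫ y, D.payoff a y ∂(D.Qm θ a)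

/-- The set `F(μ)` of optimal actions under the belief `μ`. -/
def F (D : DecisionProblem A Θ Y) (μ : ProbabilityMeasure Θ) : Set A :=
  {a | ∀ b, ∫ θ, D.U b θ ∂(μ : Measure Θ) ≤ ∫ θ, D.U a θ ∂(μ : Measure Θ)}

/-- The Kullback–Leibler divergence `K(θ, a)` of `Q_θ(· | a)` from `Q(· | a)`. -/
noncomputable def K (D : DecisionProblem A Θ Y) (θ : Θ) (a : A) : ℝ :=
  ∫ y, Real.log ((D.q a y : ℝ) / (D.qm θ a y : ℝ)) * (D.q a y : ℝ) ∂D.ν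

/-- The set of minimizers of the Kullback–Leibler divergence averaged over the action
distribution `σ`. -/
def minimizers (D : DecisionProblem A Θ Y) (σ : ProbabilityMeasure A) : Set Θ :=
  {θ | ∀ θ', ∫ a, D.K θ a ∂(σ : Measure A) ≤ ∫ a, D.K θ' a ∂(σ : Measure A)}

/-- `σ` is a Berk–Nash equilibrium. -/
def IsBerkNash (D : DecisionProblem A Θ Y) (σ : ProbabilityMeasure A) : Prop :=
  ∃ μ : ProbabilityMeasure Θ,
    (σ : Measure A).support ⊆ D.F μ ∧ (μ : Measure Θ).support ⊆ D.minimizers σ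

/-- The normalizing constant in Bayes' rule: the likelihood of the observation `x = (a, y)`
under the belief `μ`. -/
noncomputable def evidence (D : DecisionProblem A Θ Y) (μ : ProbabilityMeasure Θ) (x : A × Y) :
    ℝ≥0∞ :=
  ∫⁻ θ, D.qm θ x.1 x.2 ∂(μ : Measure Θ)

/-- The right-hand side of Bayes' rule, the measure
`B ↦ ∫_B q_θ(y | a) μ(dθ) / ∫_Θ q_θ(y | a) μ(dθ)`. -/
noncomputable def bayesMeasure (D : DecisionProblem A Θ Y) (μ : ProbabilityMeasure Θ)
    (x : A × Y) : Measure Θ :=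
  (D.evidence μ x)⁻¹ • (μ : Measure Θ).withDensity fun θ => (D.qm θ x.1 x.2 : ℝ≥0∞)

lemma isProbabilityMeasure_bayesMeasure (D : DecisionProblem A Θ Y) (μ : ProbabilityMeasure Θ)
    (x : A × Y) (h : D.evidence μ x ≠ 0 ∧ D.evidence μ x ≠ ∞) :
    IsProbabilityMeasure (D.bayesMeasure μ x) := by
  constructor
  simp only [bayesMeasure, Measure.smul_apply, smul_eq_mul,
    withDensity_apply _ MeasurableSet.univ, Measure.restrict_univ]
  exact ENNReal.inv_mul_cancel h.1 h.2

/-- The Bayesian posterior, where Bayes' rule is defined. -/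
noncomputable def bayes (D : DecisionProblem A Θ Y) (μ : ProbabilityMeasure Θ) (x : A × Y)
    (h : D.evidence μ x ≠ 0 ∧ D.evidence μ x ≠ ∞) : ProbabilityMeasure Θ :=
  ⟨D.bayesMeasure μ x, D.isProbabilityMeasure_bayesMeasure μ x h⟩

open Classical in
/-- Bayesian updating of the belief `μ` after the observation `x = (a, y)`. On observations with
a zero or infinite normalizing constant, where Bayes' rule is undefined (they have probability
zero along the process below), the belief is kept. -/
noncomputable def update (D : DecisionProblem A Θ Y) (μ : ProbabilityMeasure Θ) (x : A × Y) :
    ProbabilityMeasure Θ :=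
  if h : D.evidence μ x ≠ 0 ∧ D.evidence μ x ≠ ∞ then D.bayes μ x h else μ

/-- The belief held after the observations `h 0, …, h n`, starting from the prior `μ₀`. -/
noncomputable def posterior (D : DecisionProblem A Θ Y) (μ₀ : ProbabilityMeasure Θ) :
    (n : ℕ) → (Finset.Iic n → A × Y) → ProbabilityMeasure Θ
  | 0, h => D.update μ₀ (h ⟨0, Finset.mem_Iic.2 le_rfl⟩)
  | n + 1, h => D.update
      (D.posterior μ₀ n fun i => h ⟨i, Finset.mem_Iic.2 ((Finset.mem_Iic.1 i.2).trans n.le_succ)⟩)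
      (h ⟨n + 1, Finset.mem_Iic.2 le_rfl⟩)

lemma measurable_setLIntegral (D : DecisionProblem A Θ Y) {B : Set Θ} (hB : MeasurableSet B) :
    Measurable fun p : ProbabilityMeasure Θ × A × Y =>
      ∫⁻ θ in B, (D.qm θ p.2.1 p.2.2 : ℝ≥0∞) ∂(p.1 : Measure Θ) := by
  let κ : Kernel (ProbabilityMeasure Θ × A × Y) Θ :=
    ⟨fun p => (p.1 : Measure Θ), measurable_subtype_coe.comp measurable_fst⟩
  have : IsMarkovKernel κ := ⟨fun p => inferInstanceAs (IsProbabilityMeasure (p.1 : Measure Θ))⟩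
  have hq : Measurable fun z : (ProbabilityMeasure Θ × A × Y) × Θ =>
      (D.qm z.2 z.1.2.1 z.1.2.2 : ℝ≥0∞) :=
    (D.measurable_qm.comp
      (measurable_snd.prodMk (measurable_snd.comp measurable_fst))).coe_nnreal_ennreal
  exact Measurable.setLIntegral_kernel_prod_right (κ := κ)
    (f := fun p θ => (D.qm θ p.2.1 p.2.2 : ℝ≥0∞)) hq hB

lemma measurable_update (D : DecisionProblem A Θ Y) :
    Measurable fun p : ProbabilityMeasure Θ × A × Y => D.update p.1 p.2 := by
  have hE : Measurable fun p : ProbabilityMeasure Θ × A × Y => D.evidence p.1 p.2 := by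
    simpa only [evidence, Measure.restrict_univ] using D.measurable_setLIntegral MeasurableSet.univ
  have hS : MeasurableSet {p : ProbabilityMeasure Θ × A × Y |
      D.evidence p.1 p.2 ≠ 0 ∧ D.evidence p.1 p.2 ≠ ∞} :=
    (hE (measurableSet_singleton 0).compl).inter (hE (measurableSet_singleton ∞).compl)
  classical
  have hval : Measurable fun p : ProbabilityMeasure Θ × A × Y =>
      if D.evidence p.1 p.2 ≠ 0 ∧ D.evidence p.1 p.2 ≠ ∞ then D.bayesMeasure p.1 p.2
      else (p.1 : Measure Θ) := by
    refine Measurable.ite hS ?_ (measurable_subtype_coe.comp measurable_fst)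
    refine Measure.measurable_of_measurable_coe _ fun B hB => ?_
    simp only [bayesMeasure, Measure.smul_apply, smul_eq_mul, withDensity_apply _ hB]
    exact hE.inv.mul (D.measurable_setLIntegral hB)
  have heq : (fun p : ProbabilityMeasure Θ × A × Y => (D.update p.1 p.2 : Measure Θ)) =
      fun p => if D.evidence p.1 p.2 ≠ 0 ∧ D.evidence p.1 p.2 ≠ ∞ then D.bayesMeasure p.1 p.2
        else (p.1 : Measure Θ) := by
    funext p
    by_cases h : D.evidence p.1 p.2 ≠ 0 ∧ D.evidence p.1 p.2 ≠ ∞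
    · rw [update, dif_pos h, if_pos h]
      rfl
    · rw [update, dif_neg h, if_neg h]
  have hsub : Measurable fun p : ProbabilityMeasure Θ × A × Y =>
      (D.update p.1 p.2 : Measure Θ) := heq ▸ hval
  exact hsub.subtype_mk (h := fun p => (D.update p.1 p.2).2)

lemma measurable_posterior (D : DecisionProblem A Θ Y) (μ₀ : ProbabilityMeasure Θ) (n : ℕ) :
    Measurable (D.posterior μ₀ n) := by
  induction n with
  | zero =>
    have : D.posterior μ₀ 0 = fun h => D.update μ₀ (h ⟨0, Finset.mem_Iic.2 le_rfl⟩) := by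
      funext h
      rw [posterior]
    rw [this]
    exact D.measurable_update.comp (measurable_const.prodMk (measurable_pi_apply _))
  | succ n ih =>
    have : D.posterior μ₀ (n + 1) = fun h => D.update
        (D.posterior μ₀ n fun i =>
          h ⟨i, Finset.mem_Iic.2 ((Finset.mem_Iic.1 i.2).trans n.le_succ)⟩)
        (h ⟨n + 1, Finset.mem_Iic.2 le_rfl⟩) := by
      funext h
      rw [posterior]
    rw [this]
    exact D.measurable_update.comp
      ((ih.comp (measurable_pi_lambda _ fun i => measurable_pi_apply _)).prodMk
        (measurable_pi_apply _))

/-- One period of play as a kernel from beliefs to pairs (action, consequence): the action is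
drawn from the selection rule `φ(· | μ)` and then the consequence from `Q(· | a)`. -/
noncomputable def stepKernel (D : DecisionProblem A Θ Y) (φ : Kernel (ProbabilityMeasure Θ) A) :
    Kernel (ProbabilityMeasure Θ) (A × Y) :=
  φ ⊗ₖ Kernel.prodMkLeft (ProbabilityMeasure Θ) D.Q

instance (D : DecisionProblem A Θ Y) (φ : Kernel (ProbabilityMeasure Θ) A) [IsMarkovKernel φ] :
    IsMarkovKernel (D.stepKernel φ) := by
  unfold stepKernel
  infer_instance

/-- The conditional law of the pair (action, consequence) of period `n + 1` given those of the
periods `0, …, n`. -/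
noncomputable def transition (D : DecisionProblem A Θ Y) (μ₀ : ProbabilityMeasure Θ)
    (φ : ℕ → Kernel (ProbabilityMeasure Θ) A) (n : ℕ) :
    Kernel (Finset.Iic n → A × Y) (A × Y) :=
  (D.stepKernel (φ (n + 1))).comap (D.posterior μ₀ n) (D.measurable_posterior μ₀ n)

instance (D : DecisionProblem A Θ Y) (μ₀ : ProbabilityMeasure Θ)
    (φ : ℕ → Kernel (ProbabilityMeasure Θ) A) [∀ t, IsMarkovKernel (φ t)] (n : ℕ) :
    IsMarkovKernel (D.transition μ₀ φ n) := by
  unfold transition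
  infer_instance

/-- The law on infinite sequences of pairs (action, consequence) that the prior `μ₀`, the
selection rules `φ` and the true kernel induce (periods are numbered from `0`, so that the belief
in period `0` is the prior). -/
noncomputable def law (D : DecisionProblem A Θ Y) (μ₀ : ProbabilityMeasure Θ)
    (φ : ℕ → Kernel (ProbabilityMeasure Θ) A) [∀ t, IsMarkovKernel (φ t)] :
    Measure (ℕ → A × Y) :=
  Kernel.trajMeasure (X := fun _ => A × Y) (D.stepKernel (φ 0) μ₀) (D.transition μ₀ φ)

end DecisionProblem

end BerkNash

/-! The belief of period n has a density proportional to exp(-∑_{i<n} llr_θ(a_i, y_i)) with respect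
to the prior. Given the past and a_i, the term llr_θ(a_i, y_i) has mean K(θ, a_i), so the centred
terms are orthogonal; |llr_θ| ≤ log M and log² M ≤ 4 M bound their second moments by a multiple of ∫
M r dν. A strong law for orthogonal variables, continuity of `K` and a Cesàro average give (1/n) ∑
llr_θ → K(θ, a*) when a_t → a*. The same law for the modulus of continuity of llr in θ makes this
uniform near each parameter (`IsTypical.exists_isOpen_abs_sum_llr_le`).

Hence, if K(θ₂, a*) < K(θ₁, a*), the belief near θ₁ is exponentially small relative to the belief
near θ₂, where the full-support prior has mass, and so it vanishes
(`IsTypical.exists_isOpen_tendsto_belief`). By compactness of ΔΘ the beliefs have a weak limit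
point, and it is supported in the minimizers at a*. Optimality of a_t under the current belief
passes to the limit because the optimality correspondence has a closed graph (`mem_F_of_tendsto`).

The exceptional null set must not depend on a*. This is why `IsTypical` involves only countably many
parameters and scales and centres at the actions actually played, never at their limit. -/

namespace BerkNash

/-! ### Strong law of large numbers for orthogonal variables -/

/-- A sequence of random variables whose second moments are summable tends to zero. -/
lemma ae_tendsto_zero_of_summable_sq {Ω : Type*} [MeasurableSpace Ω] {P : Measure Ω}
    {f : ℕ → Ω → ℝ} (hf : ∀ k, MemLp (f k) 2 P) {c : ℕ → ℝ} (hc : Summable c)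
    (hfc : ∀ k, ∫ ω, f k ω ^ 2 ∂P ≤ c k) :
    ∀ᵐ ω ∂P, Tendsto (fun k => f k ω) atTop (𝓝 0) := by
  have hlt : ∫⁻ ω, ∑' k, ENNReal.ofReal (f k ω ^ 2) ∂P ≠ ∞ := by
    rw [lintegral_tsum fun k => ((hf k).aemeasurable.pow_const 2).ennreal_ofReal]
    refine ne_top_of_le_ne_top hc.tsum_ofReal_ne_top (ENNReal.tsum_le_tsum fun k => ?_)
    rw [← ofReal_integral_eq_lintegral_ofReal (hf k).integrable_sq
      (ae_of_all _ fun _ => sq_nonneg _)]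
    exact ENNReal.ofReal_le_ofReal (hfc k)
  have hmeas : AEMeasurable (fun ω => ∑' k, ENNReal.ofReal (f k ω ^ 2)) P :=
    AEMeasurable.tsum fun k => ((hf k).aemeasurable.pow_const 2).ennreal_ofReal
  filter_upwards [ae_lt_top' hmeas hlt] with ω hω
  have h0 := ENNReal.tendsto_atTop_zero_of_tsum_ne_top hω.ne
  have h1 : Tendsto (fun k => f k ω ^ 2) atTop (𝓝 0) := by
    have := (ENNReal.tendsto_toReal (a := 0) (by simp)).comp h0
    refine this.congr fun k => ?_
    simp [ENNReal.toReal_ofReal (sq_nonneg (f k ω))]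
  have h2 := (Real.continuous_sqrt.tendsto 0).comp h1
  rw [Real.sqrt_zero] at h2
  rw [tendsto_zero_iff_abs_tendsto_zero]
  exact h2.congr fun k => by simp [Real.sqrt_sq_eq_abs]

/-- The second moment of a sum of pairwise orthogonal random variables. -/
lemma integral_sum_sq_le {Ω : Type*} [MeasurableSpace Ω] {P : Measure Ω}
    {X : ℕ → Ω → ℝ} (hX : ∀ n, MemLp (X n) 2 P) {C : ℝ} (hC : ∀ n, ∫ ω, X n ω ^ 2 ∂P ≤ C)
    (horth : ∀ i j, i < j → ∫ ω, X i ω * X j ω ∂P = 0) (s : Finset ℕ) :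
    ∫ ω, (∑ i ∈ s, X i ω) ^ 2 ∂P ≤ s.card * C := by
  have hint : ∀ i j, Integrable (fun ω => X i ω * X j ω) P := fun i j =>
    (hX i).integrable_mul (hX j)
  simp only [sq, Finset.sum_mul_sum]
  rw [integral_finsetSum _ fun i _ => integrable_finsetSum _ fun j _ => hint i j]
  rw [← nsmul_eq_mul, ← Finset.sum_const]
  refine Finset.sum_le_sum fun i hi => ?_
  rw [integral_finsetSum _ fun j _ => hint i j, Finset.sum_eq_single_of_mem i hi]
  · simpa [sq] using hC i
  · intro j _ hji
    rcases hji.lt_or_gt with h | h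
    · simpa [mul_comm] using horth j i h
    · exact horth i j h

/-- The second moment of a sum of absolute values. -/
lemma integral_sum_abs_sq_le {Ω : Type*} [MeasurableSpace Ω] {P : Measure Ω}
    {X : ℕ → Ω → ℝ} (hX : ∀ n, MemLp (X n) 2 P) {C : ℝ} (hC : ∀ n, ∫ ω, X n ω ^ 2 ∂P ≤ C)
    (s : Finset ℕ) :
    ∫ ω, (∑ i ∈ s, |X i ω|) ^ 2 ∂P ≤ (s.card : ℝ) ^ 2 * C := by
  have hle : ∀ ω, (∑ i ∈ s, |X i ω|) ^ 2 ≤ s.card * ∑ i ∈ s, X i ω ^ 2 := fun ω => by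
    simpa using sq_sum_le_card_mul_sum_sq (s := s) (f := fun i => |X i ω|)
  have hL : MemLp (fun ω => ∑ i ∈ s, |X i ω|) 2 P :=
    memLp_finsetSum s fun i _ => (hX i).abs
  calc ∫ ω, (∑ i ∈ s, |X i ω|) ^ 2 ∂P ≤ ∫ ω, s.card * ∑ i ∈ s, X i ω ^ 2 ∂P :=
        integral_mono hL.integrable_sq
          ((integrable_finsetSum _ fun i _ => (hX i).integrable_sq).const_mul _) hle
    _ = s.card * ∑ i ∈ s, ∫ ω, X i ω ^ 2 ∂P := by
        rw [integral_const_mul, integral_finsetSum _ fun i _ => (hX i).integrable_sq]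
    _ ≤ s.card * (s.card * C) := by
        gcongr
        rw [← nsmul_eq_mul, ← Finset.sum_const]
        exact Finset.sum_le_sum fun i _ => hC i
    _ = _ := by ring

/-- A strong law of large numbers for pairwise orthogonal random variables with bounded second
moments. -/
theorem ae_tendsto_average_of_orthogonal {Ω : Type*} [MeasurableSpace Ω] {P : Measure Ω}
    {X : ℕ → Ω → ℝ} (hX : ∀ n, MemLp (X n) 2 P) {C : ℝ} (hC : ∀ n, ∫ ω, X n ω ^ 2 ∂P ≤ C)
    (horth : ∀ i j, i < j → ∫ ω, X i ω * X j ω ∂P = 0) :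
    ∀ᵐ ω ∂P, Tendsto (fun n : ℕ => (∑ i ∈ Finset.range n, X i ω) / n) atTop (𝓝 0) := by
  have hC0 : 0 ≤ C := (integral_nonneg fun ω => sq_nonneg (X 0 ω)).trans (hC 0)
  -- One series serves two bounds. At n = k² orthogonality gives second moment C/k²; the block from
  -- k² to (k+1)² has 2k+1 ≤ 3k terms, and Cauchy–Schwarz gives (3k)² C/k⁴ = 9C/k².
  have hsum : Summable fun k : ℕ => 9 * C * (1 / (k : ℝ) ^ 2) :=
    (Real.summable_one_div_nat_pow.2 one_lt_two).mul_left _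
  have h1 : ∀ᵐ ω ∂P, Tendsto
      (fun k : ℕ => (∑ i ∈ Finset.range (k ^ 2), X i ω) / (k : ℝ) ^ 2) atTop (𝓝 0) := by
    refine ae_tendsto_zero_of_summable_sq (fun k => ?_) hsum fun k => ?_
    · simpa [div_eq_mul_inv] using
        (memLp_finsetSum (Finset.range (k ^ 2)) fun i _ => hX i).mul_const ((k : ℝ) ^ 2)⁻¹
    · simp only [div_pow]
      rw [integral_div]
      have := integral_sum_sq_le hX hC horth (Finset.range (k ^ 2))
      rw [Finset.card_range] at this
      rcases k.eq_zero_or_pos with rfl | hk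
      · simp
      have hk' : (0 : ℝ) < k := by exact_mod_cast hk
      rw [div_le_iff₀ (by positivity)]
      refine this.trans ?_
      push_cast
      have : 9 * C * (1 / (k : ℝ) ^ 2) * ((k : ℝ) ^ 2) ^ 2 = 9 * (k ^ 2 * C) := by
        field_simp
      rw [this]
      nlinarith [mul_nonneg (sq_nonneg (k : ℝ)) hC0]
  have h2 : ∀ᵐ ω ∂P, Tendsto
      (fun k : ℕ => (∑ i ∈ Finset.Ico (k ^ 2) ((k + 1) ^ 2), |X i ω|) / (k : ℝ) ^ 2)
      atTop (𝓝 0) := by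
    refine ae_tendsto_zero_of_summable_sq (fun k => ?_) hsum fun k => ?_
    · simpa [div_eq_mul_inv] using
        (memLp_finsetSum (Finset.Ico (k ^ 2) ((k + 1) ^ 2)) fun i _ => (hX i).abs).mul_const
          ((k : ℝ) ^ 2)⁻¹
    · simp only [div_pow]
      rw [integral_div]
      have := integral_sum_abs_sq_le hX hC (Finset.Ico (k ^ 2) ((k + 1) ^ 2))
      rcases k.eq_zero_or_pos with rfl | hk
      · simp
      have hk' : (1 : ℝ) ≤ k := by exact_mod_cast hk
      have hcard : ((Finset.Ico (k ^ 2) ((k + 1) ^ 2)).card : ℝ) = 2 * k + 1 := by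
        rw [Nat.card_Ico, Nat.cast_sub (by gcongr; omega)]
        push_cast
        ring
      rw [hcard] at this
      rw [div_le_iff₀ (by positivity)]
      refine this.trans ?_
      have : 9 * C * (1 / (k : ℝ) ^ 2) * ((k : ℝ) ^ 2) ^ 2 = (3 * k) ^ 2 * C := by
        field_simp
        ring
      rw [this]
      gcongr
      linarith
  filter_upwards [h1, h2] with ω hω1 hω2
  -- Interpolation between squares: with k = √n rounded down, the average at n is at most the
  -- average at k² plus the absolute block sum divided by k².
  have hsqrt : Tendsto Nat.sqrt atTop atTop :=
    tendsto_atTop_atTop.2 fun b => ⟨b * b, fun a ha => Nat.le_sqrt.2 ha⟩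
  have hlim := (hω1.abs.add hω2).comp hsqrt
  rw [abs_zero, add_zero] at hlim
  rw [tendsto_zero_iff_abs_tendsto_zero]
  refine squeeze_zero' (Eventually.of_forall fun n => abs_nonneg _) ?_ hlim
  filter_upwards [eventually_ge_atTop 1] with n hn
  set k := Nat.sqrt n with hk
  have hk1 : k ^ 2 ≤ n := Nat.sqrt_le' n
  have hk2 : n < (k + 1) ^ 2 := Nat.lt_succ_sqrt' n
  have hkpos : 0 < k := Nat.sqrt_pos.2 hn
  have hkR : (0 : ℝ) < (k : ℝ) ^ 2 := by positivity
  have hsplit : ∑ i ∈ Finset.range n, X i ω =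
      ∑ i ∈ Finset.range (k ^ 2), X i ω + ∑ i ∈ Finset.Ico (k ^ 2) n, X i ω :=
    (Finset.sum_range_add_sum_Ico _ hk1).symm
  have hblock : |∑ i ∈ Finset.Ico (k ^ 2) n, X i ω| ≤
      ∑ i ∈ Finset.Ico (k ^ 2) ((k + 1) ^ 2), |X i ω| :=
    (Finset.abs_sum_le_sum_abs _ _).trans (Finset.sum_le_sum_of_subset_of_nonneg
      (Finset.Ico_subset_Ico_right hk2.le) fun _ _ _ => abs_nonneg _)
  simp only [Function.comp_apply, ← hk, abs_div, abs_of_pos hkR, Nat.abs_cast]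
  rw [← add_div]
  refine div_le_div₀ (by positivity) ?_ hkR (by exact_mod_cast hk1)
  rw [hsplit]
  exact (abs_add_le _ _).trans (by gcongr)

/-! ### Processes built from one-step kernels -/

section Trajectory

set_option linter.unusedSectionVars false

variable {X : Type*} [MeasurableSpace X] {ρ : Measure X}
  {κ : (n : ℕ) → Kernel (Finset.Iic n → X) X} [∀ n, IsMarkovKernel (κ n)]

lemma map_zero_trajMeasure : (Kernel.trajMeasure (X := fun _ => X) ρ κ).map (fun ω => ω 0) = ρ := by
  have h : (Kernel.trajMeasure (X := fun _ => X) ρ κ).map (Preorder.frestrictLe (π := fun _ => X) 0) =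
      ρ.map (MeasurableEquiv.piUnique (fun _ : Finset.Iic 0 => X)).symm := by
    rw [Kernel.trajMeasure, Measure.map_comp _ _ (by fun_prop), Kernel.traj_map_frestrictLe,
      Kernel.partialTraj_self, Measure.id_comp]
  have h' : (fun ω : ℕ → X => ω 0) = (MeasurableEquiv.piUnique (fun _ : Finset.Iic 0 => X)) ∘
      (Preorder.frestrictLe (π := fun _ => X) 0) := rfl
  rw [h', ← Measure.map_map (MeasurableEquiv.measurable _) (by fun_prop), h,
    Measure.map_map (MeasurableEquiv.measurable _) (MeasurableEquiv.measurable _),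
    MeasurableEquiv.self_comp_symm, Measure.map_id]

variable [IsProbabilityMeasure ρ]

lemma ae_trajMeasure_zero {p : X → Prop} (hp : ∀ᵐ x ∂ρ, p x) : ∀ᵐ ω ∂(Kernel.trajMeasure (X := fun _ => X) ρ κ), p (ω 0) := by
  rw [← map_zero_trajMeasure (ρ := ρ) (κ := κ)] at hp
  exact ae_of_ae_map (measurable_pi_apply 0).aemeasurable hp

/-- The joint law of the history and the next coordinate is the composition-product of the history's
law with `κ n`, so a statement almost sure under each conditional law is almost sure along the
trajectory. -/
lemma ae_trajMeasure_succ (n : ℕ) {p : (Finset.Iic n → X) × X → Prop}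
    (hpm : MeasurableSet {z | p z}) (hp : ∀ h, ∀ᵐ x ∂κ n h, p (h, x)) :
    ∀ᵐ ω ∂(Kernel.trajMeasure (X := fun _ => X) ρ κ), p (Preorder.frestrictLe n ω, ω (n + 1)) := by
  have h := Measure.ae_compProd_of_ae_ae (μ := (Kernel.trajMeasure (X := fun _ => X) ρ κ).map (Preorder.frestrictLe n)) (κ := κ n) hpm
    (ae_of_all _ hp)
  rw [Kernel.map_frestrictLe_trajMeasure_compProd_eq_map_trajMeasure] at h
  exact ae_of_ae_map (by fun_prop) h

lemma ae_trajMeasure_coord {S : Set X} (hS : MeasurableSet S) (hρ : ∀ᵐ x ∂ρ, x ∈ S)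
    (hκ : ∀ n h, ∀ᵐ x ∂κ n h, x ∈ S) : ∀ᵐ ω ∂(Kernel.trajMeasure (X := fun _ => X) ρ κ), ∀ t, ω t ∈ S := by
  refine ae_all_iff.2 fun t => ?_
  cases t with
  | zero => exact ae_trajMeasure_zero (p := (· ∈ S)) hρ
  | succ n => exact ae_trajMeasure_succ n (p := fun z => z.2 ∈ S) (measurable_snd hS) (hκ n)

lemma lintegral_trajMeasure_coord_le {f : X → ℝ≥0∞} (hf : Measurable f) {C : ℝ≥0∞}
    (hρ : ∫⁻ x, f x ∂ρ ≤ C) (hκ : ∀ n h, ∫⁻ x, f x ∂κ n h ≤ C) (t : ℕ) :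
    ∫⁻ ω, f (ω t) ∂(Kernel.trajMeasure (X := fun _ => X) ρ κ) ≤ C := by
  cases t with
  | zero =>
    rw [← lintegral_map (f := f) (g := fun ω : ℕ → X => ω 0) hf (measurable_pi_apply 0),
      map_zero_trajMeasure]
    exact hρ
  | succ n =>
    have h : ∫⁻ ω, f (ω (n + 1)) ∂(Kernel.trajMeasure (X := fun _ => X) ρ κ) =
        ∫⁻ z, f z.2 ∂((Kernel.trajMeasure (X := fun _ => X) ρ κ).map fun ω => (Preorder.frestrictLe n ω, ω (n + 1))) := by
      rw [lintegral_map (f := fun z : (Finset.Iic n → X) × X => f z.2) (hf.comp measurable_snd)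
        (by fun_prop)]
    rw [h, ← Kernel.map_frestrictLe_trajMeasure_compProd_eq_map_trajMeasure,
      Measure.lintegral_compProd (f := fun z => f z.2) (hf.comp measurable_snd)]
    have : IsProbabilityMeasure ((Kernel.trajMeasure (X := fun _ => X) ρ κ).map (Preorder.frestrictLe (π := fun _ => X) n)) :=
      Measure.isProbabilityMeasure_map (by fun_prop)
    exact (lintegral_mono fun h => hκ n h).trans (by simp)

/-- A strong law of large numbers along the trajectories of a process whose one-step conditional
laws center `G` and bound its second moment. -/
theorem ae_trajMeasure_tendsto_average {G : X → ℝ} (hG : Measurable G) {C : ℝ≥0}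
    (hρ2 : ∫⁻ x, ENNReal.ofReal (G x ^ 2) ∂ρ ≤ C)
    (hκ2 : ∀ n h, ∫⁻ x, ENNReal.ofReal (G x ^ 2) ∂κ n h ≤ C)
    (hκ0 : ∀ n h, ∫ x, G x ∂κ n h = 0) :
    ∀ᵐ ω ∂(Kernel.trajMeasure (X := fun _ => X) ρ κ), Tendsto (fun n : ℕ => (∑ i ∈ Finset.range n, G (ω i)) / n) atTop (𝓝 0) := by
  have hm : ∀ t, Measurable fun ω : ℕ → X => G (ω t) := fun t => hG.comp (measurable_pi_apply t)
  have hbound := lintegral_trajMeasure_coord_le (ρ := ρ) (κ := κ) (hG.pow_const 2).ennreal_ofReal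
    hρ2 hκ2
  have hL : ∀ t, MemLp (fun ω : ℕ → X => G (ω t)) 2 (Kernel.trajMeasure (X := fun _ => X) ρ κ) := fun t => by
    rw [memLp_two_iff_integrable_sq (hm t).aestronglyMeasurable]
    refine ⟨((hm t).pow_const 2).aestronglyMeasurable, ?_⟩
    rw [hasFiniteIntegral_iff_ofReal (ae_of_all _ fun _ => sq_nonneg _)]
    exact (hbound t).trans_lt ENNReal.coe_lt_top
  refine ae_tendsto_average_of_orthogonal (C := C) hL (fun t => ?_) fun i j hij => ?_
  · rw [integral_eq_lintegral_of_nonneg_ae (ae_of_all _ fun _ => sq_nonneg _)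
      ((hm t).pow_const 2).aestronglyMeasurable]
    exact ENNReal.toReal_le_coe_of_le_coe (hbound t)
  -- The earlier factor is a function of the history up to n; integrating first over the next
  -- coordinate gives zero by `hκ0`.
  · obtain ⟨n, rfl⟩ : ∃ n, j = n + 1 := ⟨j - 1, by omega⟩
    have hi : i ∈ Finset.Iic n := Finset.mem_Iic.2 (by omega)
    let φ : (Finset.Iic n → X) × X → ℝ := fun z => G (z.1 ⟨i, hi⟩) * G z.2
    have hφ : Measurable φ :=
      (hG.comp ((measurable_pi_apply _).comp measurable_fst)).mul (hG.comp measurable_snd)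
    have hmap : Measurable fun ω : ℕ → X =>
      (Preorder.frestrictLe (π := fun _ => X) n ω, ω (n + 1)) := by fun_prop
    have hint : Integrable φ ((Kernel.trajMeasure (X := fun _ => X) ρ κ).map fun ω => (Preorder.frestrictLe n ω, ω (n + 1))) := by
      rw [integrable_map_measure hφ.aestronglyMeasurable hmap.aemeasurable]
      exact (hL i).integrable_mul (hL (n + 1))
    have heq : ∫ ω, G (ω i) * G (ω (n + 1)) ∂(Kernel.trajMeasure (X := fun _ => X) ρ κ) =
        ∫ z, φ z ∂((Kernel.trajMeasure (X := fun _ => X) ρ κ).map fun ω => (Preorder.frestrictLe n ω, ω (n + 1))) := by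
      rw [integral_map hmap.aemeasurable hφ.aestronglyMeasurable]
      rfl
    rw [heq]
    rw [← Kernel.map_frestrictLe_trajMeasure_compProd_eq_map_trajMeasure] at hint ⊢
    rw [Measure.integral_compProd hint]
    simp [φ, integral_const_mul, hκ0]

end Trajectory

end BerkNash

namespace BerkNash

namespace DecisionProblem

/-! ### Continuity of the divergence, the payoff and the log-likelihood ratio -/

section Regularity

set_option linter.unusedSectionVars false

variable {A Θ Y : Type*} [MetricSpace A] [CompactSpace A] [SecondCountableTopology A]
  [Nonempty A] [MeasurableSpace A] [BorelSpace A]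
  [MetricSpace Θ] [CompactSpace Θ] [SecondCountableTopology Θ] [Nonempty Θ]
  [MeasurableSpace Θ] [BorelSpace Θ] [MeasurableSpace Y]

/-- The consequences at which the regularity assumptions hold for all actions and parameters. -/
structure IsRegular (D : DecisionProblem A Θ Y) (y : Y) : Prop where
  continuous_q : Continuous fun a => D.q a y
  continuous_qm : Continuous fun p : Θ × A => D.qm p.1 p.2 y
  continuous_payoff : Continuous fun a => D.payoff a y
  qm_le : ∀ θ a, D.qm θ a y ≤ D.q a y * D.M y
  q_le : ∀ θ a, D.q a y ≤ D.qm θ a y * D.M y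
  q_le_r : ∀ a, D.q a y ≤ D.r y
  abs_payoff_le : ∀ a, |D.payoff a y| ≤ D.hπ y

/-- The assumed bounds have null sets depending on the action and the parameter. Imposing them on a
countable dense set costs one null set, and continuity extends them to all points. -/
lemma ae_isRegular (D : DecisionProblem A Θ Y) : ∀ᵐ y ∂D.ν, D.IsRegular y := by
  have h1 : ∀ᵐ y ∂D.ν, ∀ n : ℕ, D.qm (TopologicalSpace.denseSeq (Θ × A) n).1
      (TopologicalSpace.denseSeq (Θ × A) n).2 y * (D.M y)⁻¹ ≤
      D.q (TopologicalSpace.denseSeq (Θ × A) n).2 y := ae_all_iff.2 fun n => D.ratio_lower _ _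
  have h2 : ∀ᵐ y ∂D.ν, ∀ n : ℕ, D.q (TopologicalSpace.denseSeq (Θ × A) n).2 y ≤
      D.qm (TopologicalSpace.denseSeq (Θ × A) n).1 (TopologicalSpace.denseSeq (Θ × A) n).2 y *
        D.M y := ae_all_iff.2 fun n => D.ratio_upper _ _
  have h3 : ∀ᵐ y ∂D.ν, ∀ n : ℕ, D.q (TopologicalSpace.denseSeq A n) y ≤ D.r y :=
    ae_all_iff.2 fun n => D.q_le_r _
  have h4 : ∀ᵐ y ∂D.ν, ∀ n : ℕ, |D.payoff (TopologicalSpace.denseSeq A n) y| ≤ D.hπ y :=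
    ae_all_iff.2 fun n => D.abs_payoff_le _
  filter_upwards [D.continuous_q, D.continuous_qm, D.continuous_payoff, h1, h2, h3, h4]
    with y c1 c2 c3 h1 h2 h3 h4
  have hM : 0 < D.M y := zero_lt_one.trans_le (D.one_le_M y)
  have hd := TopologicalSpace.denseRange_denseSeq (Θ × A)
  have hdA := TopologicalSpace.denseRange_denseSeq A
  have cq : Continuous fun p : Θ × A => D.q p.2 y := c1.comp continuous_snd
  refine ⟨c1, c2, c3, fun θ a => ?_, fun θ a => ?_, fun a => ?_, fun a => ?_⟩
  · refine hd.induction_on (p := fun p : Θ × A => D.qm p.1 p.2 y ≤ D.q p.2 y * D.M y) (θ, a)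
      (isClosed_le c2 (cq.mul continuous_const)) fun n => ?_
    have := h1 n
    rwa [← div_eq_mul_inv, div_le_iff₀ hM] at this
  · exact hd.induction_on (p := fun p : Θ × A => D.q p.2 y ≤ D.qm p.1 p.2 y * D.M y) (θ, a)
      (isClosed_le cq (c2.mul continuous_const)) h2
  · exact hdA.induction_on (p := fun a => D.q a y ≤ D.r y) a
      (isClosed_le c1 continuous_const) h3
  · exact hdA.induction_on (p := fun a => |D.payoff a y| ≤ D.hπ y) a
      (isClosed_le c3.abs continuous_const) h4

/-- The log-likelihood ratio `log (q(y | a) / q_θ(y | a))`. -/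
noncomputable def llr (D : DecisionProblem A Θ Y) (θ : Θ) (a : A) (y : Y) : ℝ :=
  Real.log ((D.q a y : ℝ) / (D.qm θ a y : ℝ))

lemma measurable_llr (D : DecisionProblem A Θ Y) (θ : Θ) :
    Measurable fun x : A × Y => D.llr θ x.1 x.2 := by
  have h : Measurable fun x : A × Y => D.qm θ x.1 x.2 :=
    D.measurable_qm.comp (measurable_const.prodMk measurable_id)
  exact (D.measurable_q.coe_nnreal_real.div h.coe_nnreal_real).log

lemma one_le_M_real (D : DecisionProblem A Θ Y) (y : Y) : (1 : ℝ) ≤ D.M y := by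
  exact_mod_cast D.one_le_M y

lemma log_M_nonneg (D : DecisionProblem A Θ Y) (y : Y) : 0 ≤ Real.log (D.M y) :=
  Real.log_nonneg (D.one_le_M_real y)

lemma IsRegular.qm_pos {D : DecisionProblem A Θ Y} {y : Y} (hy : D.IsRegular y) {a : A}
    (hq : D.q a y ≠ 0) (θ : Θ) : 0 < D.qm θ a y := by
  rw [pos_iff_ne_zero]
  intro h
  have := hy.q_le θ a
  rw [h, zero_mul] at this
  exact hq (le_antisymm this zero_le)

lemma IsRegular.abs_llr_le {D : DecisionProblem A Θ Y} {y : Y} (hy : D.IsRegular y) (θ : Θ)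
    (a : A) : |D.llr θ a y| ≤ Real.log (D.M y) := by
  by_cases hq : D.q a y = 0
  -- Here the ratio is 0 and `Real.log 0 = 0`.
  · simp [llr, hq, D.log_M_nonneg]
  have hqp : (0 : ℝ) < D.q a y := by exact_mod_cast pos_iff_ne_zero.2 hq
  have hqm : (0 : ℝ) < D.qm θ a y := by exact_mod_cast hy.qm_pos hq θ
  have hM : (0 : ℝ) < D.M y := zero_lt_one.trans_le (D.one_le_M_real y)
  have h1 : (D.qm θ a y : ℝ) ≤ D.q a y * D.M y := by exact_mod_cast hy.qm_le θ a
  have h2 : (D.q a y : ℝ) ≤ D.qm θ a y * D.M y := by exact_mod_cast hy.q_le θ a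
  rw [llr, abs_le, ← Real.log_inv]
  constructor
  · apply Real.log_le_log (by positivity)
    rw [inv_eq_one_div, div_le_div_iff₀ hM hqm]
    linarith
  · apply Real.log_le_log (by positivity)
    rw [div_le_iff₀ hqm]
    linarith

/-- The log-ratio alone may jump where q vanishes, but it is bounded by log M, so the factor q
forces the product to 0 there. -/
lemma IsRegular.continuous_llr_mul_q {D : DecisionProblem A Θ Y} {y : Y} (hy : D.IsRegular y) :
    Continuous fun p : Θ × A => D.llr p.1 p.2 y * (D.q p.2 y : ℝ) := by
  have cq : Continuous fun p : Θ × A => (D.q p.2 y : ℝ) :=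
    NNReal.continuous_coe.comp (hy.continuous_q.comp continuous_snd)
  have cqm : Continuous fun p : Θ × A => (D.qm p.1 p.2 y : ℝ) :=
    NNReal.continuous_coe.comp hy.continuous_qm
  refine continuous_iff_continuousAt.2 fun p => ?_
  by_cases hq : D.q p.2 y = 0
  · have hlim : Tendsto (fun p : Θ × A => Real.log (D.M y) * (D.q p.2 y : ℝ)) (𝓝 p) (𝓝 0) := by
      have := (cq.const_mul (Real.log (D.M y))).tendsto p
      simpa [hq] using this
    rw [ContinuousAt, hq, NNReal.coe_zero, mul_zero]
    refine squeeze_zero_norm (fun p => ?_) hlim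
    rw [Real.norm_eq_abs, abs_mul, NNReal.abs_eq]
    gcongr
    exact hy.abs_llr_le _ _
  · have hqm := hy.qm_pos hq p.1
    refine ContinuousAt.mul (ContinuousAt.log (cq.continuousAt.div cqm.continuousAt ?_) ?_)
      cq.continuousAt
    · exact_mod_cast hqm.ne'
    · exact div_ne_zero (by exact_mod_cast hq) (by exact_mod_cast hqm.ne')

lemma IsRegular.continuous_llr {D : DecisionProblem A Θ Y} {y : Y} (hy : D.IsRegular y) {a : A}
    (hq : D.q a y ≠ 0) : Continuous fun θ => D.llr θ a y := by
  have h : Continuous fun θ => D.llr θ a y * (D.q a y : ℝ) :=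
    hy.continuous_llr_mul_q.comp (continuous_id.prodMk continuous_const)
  have hq' : (D.q a y : ℝ) ≠ 0 := by exact_mod_cast hq
  refine (h.div_const (D.q a y : ℝ)).congr fun θ => ?_
  rw [mul_div_cancel_right₀ _ hq']

lemma integrable_M_mul_r (D : DecisionProblem A Θ Y) :
    Integrable (fun y => (D.M y : ℝ) * D.r y) D.ν := by
  refine ⟨(D.measurable_M.coe_nnreal_real.mul D.measurable_r.coe_nnreal_real).aestronglyMeasurable,
    ?_⟩
  rw [hasFiniteIntegral_iff_ofReal (ae_of_all _ fun y => by positivity)]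
  refine lt_of_eq_of_lt (lintegral_congr fun y => ?_) D.lintegral_M_r
  rw [ENNReal.ofReal_mul (NNReal.coe_nonneg _), ENNReal.ofReal_coe_nnreal,
    ENNReal.ofReal_coe_nnreal]

lemma integrable_hπ_mul_M_mul_r (D : DecisionProblem A Θ Y) :
    Integrable (fun y => (D.hπ y : ℝ) * D.M y * D.r y) D.ν := by
  refine ⟨((D.measurable_hπ.coe_nnreal_real.mul D.measurable_M.coe_nnreal_real).mul
    D.measurable_r.coe_nnreal_real).aestronglyMeasurable, ?_⟩
  rw [hasFiniteIntegral_iff_ofReal (ae_of_all _ fun y => by positivity)]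
  refine lt_of_eq_of_lt (lintegral_congr fun y => ?_) D.lintegral_hπ_M_r
  rw [ENNReal.ofReal_mul (by positivity), ENNReal.ofReal_mul (by positivity),
    ENNReal.ofReal_coe_nnreal, ENNReal.ofReal_coe_nnreal, ENNReal.ofReal_coe_nnreal]

lemma log_M_le_M (D : DecisionProblem A Θ Y) (y : Y) : Real.log (D.M y) ≤ D.M y :=
  Real.log_le_self (NNReal.coe_nonneg _)

lemma measurable_q_action (D : DecisionProblem A Θ Y) (a : A) : Measurable fun y => D.q a y :=
  D.measurable_q.comp (measurable_const.prodMk measurable_id)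

lemma measurable_qm_action (D : DecisionProblem A Θ Y) (θ : Θ) (a : A) :
    Measurable fun y => D.qm θ a y :=
  D.measurable_qm.comp (measurable_const.prodMk (measurable_const.prodMk measurable_id))

lemma integral_Q (D : DecisionProblem A Θ Y) (a : A) (f : Y → ℝ) :
    ∫ y, f y ∂D.Q a = ∫ y, f y * (D.q a y : ℝ) ∂D.ν := by
  rw [D.Q_eq, integral_withDensity_eq_integral_smul (D.measurable_q_action a)]
  simp [NNReal.smul_def, mul_comm]

lemma K_eq (D : DecisionProblem A Θ Y) (θ : Θ) (a : A) : D.K θ a = ∫ y, D.llr θ a y ∂D.Q a := by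
  rw [integral_Q]
  rfl

/-- Dominated convergence: |llr| q ≤ (log M) r ≤ M r. -/
lemma continuous_K (D : DecisionProblem A Θ Y) : Continuous fun p : Θ × A => D.K p.1 p.2 := by
  unfold K
  refine continuous_of_dominated (bound := fun y => (D.M y : ℝ) * D.r y) (fun p => ?_)
    (fun p => ?_) D.integrable_M_mul_r ?_
  · exact ((D.measurable_llr p.1).comp (measurable_const.prodMk measurable_id)).mul
      (D.measurable_q_action p.2).coe_nnreal_real |>.aestronglyMeasurable
  · filter_upwards [D.ae_isRegular] with y hy
    rw [Real.norm_eq_abs, abs_mul, NNReal.abs_eq]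
    exact mul_le_mul ((hy.abs_llr_le _ _).trans (D.log_M_le_M y))
      (by exact_mod_cast hy.q_le_r p.2) (NNReal.coe_nonneg _) (NNReal.coe_nonneg _)
  · filter_upwards [D.ae_isRegular] with y hy
    exact hy.continuous_llr_mul_q

/-- Dominated convergence: q_θ ≤ q M ≤ r M, so the integrand is at most hπ M r. -/
lemma continuous_U (D : DecisionProblem A Θ Y) : Continuous fun p : A × Θ => D.U p.1 p.2 := by
  have hU : (fun p : A × Θ => D.U p.1 p.2) =
      fun p => ∫ y, (D.qm p.2 p.1 y : ℝ) * D.payoff p.1 y ∂D.ν := by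
    funext p
    rw [U, D.Qm_eq, integral_withDensity_eq_integral_smul (D.measurable_qm_action p.2 p.1)]
    rfl
  rw [hU]
  refine continuous_of_dominated (bound := fun y => (D.hπ y : ℝ) * D.M y * D.r y) (fun p => ?_)
    (fun p => ?_) D.integrable_hπ_mul_M_mul_r ?_
  · exact (D.measurable_qm_action p.2 p.1).coe_nnreal_real.aestronglyMeasurable.mul
      (D.aestronglyMeasurable_payoff p.1)
  · filter_upwards [D.ae_isRegular] with y hy
    rw [Real.norm_eq_abs, abs_mul, NNReal.abs_eq]
    have h1 : (D.qm p.2 p.1 y : ℝ) ≤ D.r y * D.M y := by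
      exact_mod_cast (hy.qm_le p.2 p.1).trans (mul_le_mul_left (hy.q_le_r p.1) _)
    calc (D.qm p.2 p.1 y : ℝ) * |D.payoff p.1 y| ≤ (D.r y * D.M y) * D.hπ y :=
          mul_le_mul h1 (hy.abs_payoff_le p.1) (abs_nonneg _) (by positivity)
      _ = _ := by ring
  · filter_upwards [D.ae_isRegular] with y hy
    exact (NNReal.continuous_coe.comp (hy.continuous_qm.comp continuous_swap)).mul
      (hy.continuous_payoff.comp continuous_fst)

/-- The modulus of continuity, at scale `1 / (N + 1)`, of the log-likelihood ratio in the
parameter, computed along a countable dense set of parameters. -/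
noncomputable def modulus (D : DecisionProblem A Θ Y) (N : ℕ) (a : A) (y : Y) : ℝ :=
  ⨆ p : {p : ℕ × ℕ // dist (TopologicalSpace.denseSeq Θ p.1) (TopologicalSpace.denseSeq Θ p.2) <
      1 / ((N : ℝ) + 1)},
    |D.llr (TopologicalSpace.denseSeq Θ p.1.1) a y - D.llr (TopologicalSpace.denseSeq Θ p.1.2) a y|

lemma measurable_modulus (D : DecisionProblem A Θ Y) (N : ℕ) :
    Measurable fun x : A × Y => D.modulus N x.1 x.2 :=
  Measurable.iSup fun _ => ((D.measurable_llr _).sub (D.measurable_llr _)).abs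

lemma modulus_nonneg (D : DecisionProblem A Θ Y) (N : ℕ) (a : A) (y : Y) :
    0 ≤ D.modulus N a y :=
  Real.iSup_nonneg fun _ => abs_nonneg _

lemma modulus_le (D : DecisionProblem A Θ Y) {N : ℕ} {a : A} {y : Y} {c : ℝ} (hc : 0 ≤ c)
    (h : ∀ θ θ', dist θ θ' < 1 / ((N : ℝ) + 1) → |D.llr θ a y - D.llr θ' a y| ≤ c) :
    D.modulus N a y ≤ c :=
  Real.iSup_le (fun p => h _ _ p.2) hc

lemma IsRegular.abs_llr_sub_le {D : DecisionProblem A Θ Y} {y : Y} (hy : D.IsRegular y)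
    (θ θ' : Θ) (a : A) : |D.llr θ a y - D.llr θ' a y| ≤ 2 * Real.log (D.M y) :=
  (abs_sub _ _).trans (by linarith [hy.abs_llr_le θ a, hy.abs_llr_le θ' a])

lemma IsRegular.modulus_le_log {D : DecisionProblem A Θ Y} {y : Y} (hy : D.IsRegular y)
    (N : ℕ) (a : A) : D.modulus N a y ≤ 2 * Real.log (D.M y) :=
  D.modulus_le (by linarith [D.log_M_nonneg y]) fun _ _ _ => hy.abs_llr_sub_le _ _ _

/-- Closeness is a strict, hence open, condition on the pair, so dense pairs satisfying it
approximate every such pair; where q ≠ 0 the log-ratio is continuous in θ and the bound passes to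
the limit. -/
lemma IsRegular.abs_llr_sub_le_modulus {D : DecisionProblem A Θ Y} {y : Y} (hy : D.IsRegular y)
    {a : A} (hq : D.q a y ≠ 0) {N : ℕ} {θ θ' : Θ} (h : dist θ θ' < 1 / ((N : ℝ) + 1)) :
    |D.llr θ a y - D.llr θ' a y| ≤ D.modulus N a y := by
  have hc := hy.continuous_llr hq
  have hdense : Dense (Set.range (Prod.map (TopologicalSpace.denseSeq Θ)
      (TopologicalSpace.denseSeq Θ))) :=
    (TopologicalSpace.denseRange_denseSeq Θ).prodMap (TopologicalSpace.denseRange_denseSeq Θ)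
  have hopen : IsOpen {p : Θ × Θ | dist p.1 p.2 < 1 / ((N : ℝ) + 1)} :=
    isOpen_lt continuous_dist continuous_const
  have hclosed : IsClosed {p : Θ × Θ | |D.llr p.1 a y - D.llr p.2 a y| ≤ D.modulus N a y} :=
    isClosed_le ((hc.comp continuous_fst).sub (hc.comp continuous_snd)).abs continuous_const
  have hsub : {p : Θ × Θ | dist p.1 p.2 < 1 / ((N : ℝ) + 1)} ∩ Set.range (Prod.map
      (TopologicalSpace.denseSeq Θ) (TopologicalSpace.denseSeq Θ)) ⊆
      {p : Θ × Θ | |D.llr p.1 a y - D.llr p.2 a y| ≤ D.modulus N a y} := by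
    rintro _ ⟨hp, ⟨⟨i, j⟩, rfl⟩⟩
    -- A real supremum needs boundedness, since an unbounded one defaults to 0; 2 log M is a bound.
    refine le_ciSup (f := fun p : {p : ℕ × ℕ // dist (TopologicalSpace.denseSeq Θ p.1)
      (TopologicalSpace.denseSeq Θ p.2) < 1 / ((N : ℝ) + 1)} =>
      |D.llr (TopologicalSpace.denseSeq Θ p.1.1) a y -
        D.llr (TopologicalSpace.denseSeq Θ p.1.2) a y|) ⟨2 * Real.log (D.M y), ?_⟩ ⟨(i, j), hp⟩
    rintro _ ⟨p, rfl⟩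
    exact hy.abs_llr_sub_le _ _ _
  exact hclosed.closure_subset_iff.2 hsub (hdense.open_subset_closure_inter hopen
    (show (θ, θ') ∈ {p : Θ × Θ | dist p.1 p.2 < 1 / ((N : ℝ) + 1)} from h))

/-- Uniform continuity of llr · q on the compact product Θ × A. The action may vary with the scale,
which later gives uniformity over actions. -/
lemma IsRegular.tendsto_modulus {D : DecisionProblem A Θ Y} {y : Y} (hy : D.IsRegular y)
    (a : ℕ → A) : Tendsto (fun N => D.modulus N (a N) y * (D.q (a N) y : ℝ)) atTop (𝓝 0) := by
  have huc := CompactSpace.uniformContinuous_of_continuous hy.continuous_llr_mul_q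
  refine Metric.tendsto_atTop.2 fun ε hε => ?_
  obtain ⟨δ, hδ, h⟩ := Metric.uniformContinuous_iff.1 huc (ε / 2) (half_pos hε)
  obtain ⟨N₀, hN₀⟩ := exists_nat_one_div_lt hδ
  refine ⟨N₀, fun N hN => ?_⟩
  rw [Real.dist_eq, sub_zero,
    abs_of_nonneg (mul_nonneg (D.modulus_nonneg _ _ _) (NNReal.coe_nonneg _))]
  by_cases hq : D.q (a N) y = 0
  · simpa [hq] using hε
  have hqp : (0 : ℝ) < D.q (a N) y := by exact_mod_cast pos_iff_ne_zero.2 hq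
  refine lt_of_le_of_lt ?_ (half_lt_self hε)
  rw [← le_div_iff₀ hqp]
  refine D.modulus_le (by positivity) fun θ θ' hθ => ?_
  rw [le_div_iff₀ hqp, ← abs_of_pos hqp, ← abs_mul, sub_mul]
  have hd : dist (θ, a N) (θ', a N) < δ := by
    rw [Prod.dist_eq, dist_self, max_eq_left dist_nonneg]
    exact hθ.trans ((Nat.one_div_le_one_div hN).trans_lt hN₀)
  exact (h hd).le

lemma exists_integral_modulus_le (D : DecisionProblem A Θ Y) {ε : ℝ} (hε : 0 < ε) :
    ∃ N, ∀ a, ∫ y, D.modulus N a y ∂D.Q a ≤ ε := by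
  by_contra! hcon
  -- A bad action for every scale; dominated convergence along this sequence, with bound 2 M r,
  -- contradicts the choice.
  choose a ha using hcon
  have hlim : Tendsto (fun N => ∫ y, D.modulus N (a N) y * (D.q (a N) y : ℝ) ∂D.ν) atTop
      (𝓝 (∫ _, (0 : ℝ) ∂D.ν)) := by
    refine tendsto_integral_of_dominated_convergence
      (fun y => 2 * ((D.M y : ℝ) * D.r y)) (fun N => ?_) (D.integrable_M_mul_r.const_mul 2)
      (fun N => ?_) ?_
    · exact ((D.measurable_modulus N).comp (measurable_const.prodMk measurable_id)).mul
        (D.measurable_q_action (a N)).coe_nnreal_real |>.aestronglyMeasurable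
    · filter_upwards [D.ae_isRegular] with y hy
      rw [Real.norm_eq_abs, abs_mul, NNReal.abs_eq, abs_of_nonneg (D.modulus_nonneg _ _ _),
        ← mul_assoc]
      exact mul_le_mul ((hy.modulus_le_log _ _).trans (by linarith [D.log_M_le_M y]))
        (by exact_mod_cast hy.q_le_r (a N)) (NNReal.coe_nonneg _) (by positivity)
    · filter_upwards [D.ae_isRegular] with y hy
      exact hy.tendsto_modulus a
  rw [integral_zero] at hlim
  obtain ⟨N, hN⟩ := (hlim.eventually (gt_mem_nhds hε)).exists
  exact absurd (ha N) (by rw [integral_Q]; exact hN.le.not_gt)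

end Regularity

end DecisionProblem

end BerkNash

namespace BerkNash

namespace DecisionProblem

/-! ### The strong law under the induced law -/

section Law

set_option linter.unusedSectionVars false

variable {A Θ Y : Type*} [MetricSpace A] [CompactSpace A] [SecondCountableTopology A]
  [Nonempty A] [MeasurableSpace A] [BorelSpace A]
  [MetricSpace Θ] [CompactSpace Θ] [SecondCountableTopology Θ] [Nonempty Θ]
  [MeasurableSpace Θ] [BorelSpace Θ] [MeasurableSpace Y]

lemma ae_stepKernel (D : DecisionProblem A Θ Y) (φ : Kernel (ProbabilityMeasure Θ) A)
    [IsMarkovKernel φ] (μ : ProbabilityMeasure Θ) {S : Set (A × Y)} (hS : MeasurableSet S)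
    (h : ∀ᵐ a ∂φ μ, ∀ᵐ y ∂D.Q a, (a, y) ∈ S) : ∀ᵐ x ∂D.stepKernel φ μ, x ∈ S := by
  unfold stepKernel
  refine Kernel.ae_compProd_of_ae_ae (p := (· ∈ S)) hS ?_
  filter_upwards [h] with a ha
  rwa [Kernel.prodMkLeft_apply]

lemma Q_absolutelyContinuous (D : DecisionProblem A Θ Y) (a : A) : D.Q a ≪ D.ν := by
  rw [D.Q_eq]
  exact withDensity_absolutelyContinuous _ _

lemma ae_Q_isRegular (D : DecisionProblem A Θ Y) (a : A) : ∀ᵐ y ∂D.Q a, D.IsRegular y :=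
  (D.Q_absolutelyContinuous a).ae_le D.ae_isRegular

lemma ae_Q_q_ne_zero (D : DecisionProblem A Θ Y) (a : A) : ∀ᵐ y ∂D.Q a, D.q a y ≠ 0 := by
  rw [D.Q_eq, ae_withDensity_iff (D.measurable_q_action a).coe_nnreal_ennreal]
  exact ae_of_all _ fun y hy => by exact_mod_cast hy

lemma ae_law_isRegular (D : DecisionProblem A Θ Y) (μ₀ : ProbabilityMeasure Θ)
    (φ : ℕ → Kernel (ProbabilityMeasure Θ) A) [∀ t, IsMarkovKernel (φ t)] :
    ∀ᵐ ω ∂D.law μ₀ φ, ∀ t, D.IsRegular (ω t).2 ∧ D.q (ω t).1 (ω t).2 ≠ 0 := by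
  -- Regularity need not be a measurable condition, so the irregular points are enclosed in a
  -- measurable null set.
  let B := toMeasurable D.ν {y | ¬ D.IsRegular y}
  have hB : D.ν B = 0 := by rw [measure_toMeasurable]; exact D.ae_isRegular
  let S : Set (A × Y) := {x | x.2 ∈ Bᶜ} ∩ {x | D.q x.1 x.2 ≠ 0}
  have hS : MeasurableSet S := (measurable_snd (measurableSet_toMeasurable _ _).compl).inter
    (D.measurable_q (measurableSet_singleton 0).compl)
  have hstep : ∀ t μ, ∀ᵐ x ∂D.stepKernel (φ t) μ, x ∈ S := fun t μ =>
    D.ae_stepKernel (φ t) μ hS <| ae_of_all _ fun a => by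
      have h1 : ∀ᵐ y ∂D.Q a, y ∈ Bᶜ :=
        (D.Q_absolutelyContinuous a).ae_le (measure_eq_zero_iff_ae_notMem.1 hB)
      filter_upwards [h1, D.ae_Q_q_ne_zero a] with y hy1 hy2 using ⟨hy1, hy2⟩
  have := ae_trajMeasure_coord (ρ := D.stepKernel (φ 0) μ₀) (κ := D.transition μ₀ φ) hS
    (hstep 0 μ₀) fun n h => hstep (n + 1) (D.posterior μ₀ n h)
  filter_upwards [this] with ω hω t
  exact ⟨not_not.1 fun h => (hω t).1 (subset_toMeasurable _ _ h), (hω t).2⟩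

lemma lintegral_M_Q_le (D : DecisionProblem A Θ Y) (a : A) :
    ∫⁻ y, D.M y ∂D.Q a ≤ ∫⁻ y, (D.M y : ℝ≥0∞) * D.r y ∂D.ν := by
  rw [D.Q_eq, lintegral_withDensity_eq_lintegral_mul _
    (D.measurable_q_action a).coe_nnreal_ennreal D.measurable_M.coe_nnreal_ennreal]
  refine lintegral_mono_ae ?_
  filter_upwards [D.q_le_r a] with y hy
  rw [Pi.mul_apply, mul_comm]
  gcongr

/-- From log √M ≤ √M one gets 2 log M ≤ 4 √M, whose square is 16 M. Thus integrability of M r alone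
bounds second moments, uniformly in the action. -/
lemma lintegral_sq_Q_le (D : DecisionProblem A Θ Y) {f : Y → ℝ} {a : A}
    (hfM : ∀ y, D.IsRegular y → |f y| ≤ 2 * Real.log (D.M y)) :
    ∫⁻ y, ENNReal.ofReal (f y ^ 2) ∂D.Q a ≤ 16 * ∫⁻ y, (D.M y : ℝ≥0∞) * D.r y ∂D.ν := by
  calc ∫⁻ y, ENNReal.ofReal (f y ^ 2) ∂D.Q a ≤ ∫⁻ y, 16 * (D.M y : ℝ≥0∞) ∂D.Q a := by
        refine lintegral_mono_ae ?_
        filter_upwards [D.ae_Q_isRegular a] with y hy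
        have hM0 : (0 : ℝ) ≤ D.M y := NNReal.coe_nonneg _
        have h1 : Real.log (D.M y) ≤ 2 * √(D.M y : ℝ) := by
          have h2 := Real.log_le_self (Real.sqrt_nonneg (D.M y : ℝ))
          rw [Real.log_sqrt hM0] at h2
          linarith
        have h2 : |f y| ≤ 4 * √(D.M y : ℝ) := (hfM y hy).trans (by linarith)
        have h3 : f y ^ 2 ≤ 16 * D.M y := by
          rw [← sq_abs]
          refine (pow_le_pow_left₀ (abs_nonneg _) h2 2).trans_eq ?_
          rw [mul_pow, Real.sq_sqrt hM0]
          norm_num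
        refine (ENNReal.ofReal_le_ofReal h3).trans_eq ?_
        rw [ENNReal.ofReal_mul (by norm_num), ENNReal.ofReal_coe_nnreal]
        norm_num
    _ = 16 * ∫⁻ y, (D.M y : ℝ≥0∞) ∂D.Q a :=
        lintegral_const_mul _ D.measurable_M.coe_nnreal_ennreal
    _ ≤ _ := mul_le_mul_right (D.lintegral_M_Q_le a) _

lemma memLp_two_Q (D : DecisionProblem A Θ Y) {f : Y → ℝ} (hf : Measurable f) (a : A)
    (hfM : ∀ y, D.IsRegular y → |f y| ≤ 2 * Real.log (D.M y)) : MemLp f 2 (D.Q a) := by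
  rw [memLp_two_iff_integrable_sq hf.aestronglyMeasurable]
  refine ⟨(hf.pow_const 2).aestronglyMeasurable, ?_⟩
  rw [hasFiniteIntegral_iff_ofReal (ae_of_all _ fun _ => sq_nonneg _)]
  exact (D.lintegral_sq_Q_le hfM).trans_lt (ENNReal.mul_lt_top (by norm_num) D.lintegral_M_r)

lemma lintegral_sub_integral_sq_Q_le (D : DecisionProblem A Θ Y) {f : Y → ℝ} (hf : Measurable f)
    (a : A) (hfM : ∀ y, D.IsRegular y → |f y| ≤ 2 * Real.log (D.M y)) :
    ∫⁻ y, ENNReal.ofReal ((f y - ∫ y', f y' ∂D.Q a) ^ 2) ∂D.Q a ≤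
      16 * ∫⁻ y, (D.M y : ℝ≥0∞) * D.r y ∂D.ν := by
  have hL := D.memLp_two_Q hf a hfM
  rw [← evariance_eq_lintegral_ofReal, ← ofReal_variance hL]
  refine (ENNReal.ofReal_le_ofReal
    (variance_le_expectation_sq hf.aestronglyMeasurable)).trans ?_
  simp only [Pi.pow_apply]
  rw [ofReal_integral_eq_lintegral_ofReal hL.integrable_sq (ae_of_all _ fun _ => sq_nonneg _)]
  exact D.lintegral_sq_Q_le hfM

lemma lintegral_stepKernel_le (D : DecisionProblem A Θ Y) (φ : Kernel (ProbabilityMeasure Θ) A)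
    [IsMarkovKernel φ] (μ : ProbabilityMeasure Θ) {g : A × Y → ℝ≥0∞} (hg : Measurable g)
    {C : ℝ≥0∞} (h : ∀ a, ∫⁻ y, g (a, y) ∂D.Q a ≤ C) : ∫⁻ x, g x ∂D.stepKernel φ μ ≤ C := by
  rw [stepKernel, Kernel.lintegral_compProd _ _ _ hg]
  simp only [Kernel.prodMkLeft_apply]
  exact (lintegral_mono fun a => h a).trans (by simp)

lemma integral_stepKernel_eq_zero (D : DecisionProblem A Θ Y)
    (φ : Kernel (ProbabilityMeasure Θ) A) [IsMarkovKernel φ] (μ : ProbabilityMeasure Θ)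
    {g : A × Y → ℝ} (hg : Measurable g) {C : ℝ≥0}
    (h2 : ∫⁻ x, ENNReal.ofReal (g x ^ 2) ∂D.stepKernel φ μ ≤ C)
    (h : ∀ a, ∫ y, g (a, y) ∂D.Q a = 0) : ∫ x, g x ∂D.stepKernel φ μ = 0 := by
  have hint : Integrable g (D.stepKernel φ μ) := by
    refine MemLp.integrable one_le_two ?_
    rw [memLp_two_iff_integrable_sq hg.aestronglyMeasurable]
    refine ⟨(hg.pow_const 2).aestronglyMeasurable, ?_⟩
    rw [hasFiniteIntegral_iff_ofReal (ae_of_all _ fun _ => sq_nonneg _)]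
    exact h2.trans_lt ENNReal.coe_lt_top
  rw [stepKernel] at hint ⊢
  rw [ProbabilityTheory.integral_compProd hint]
  simp only [Kernel.prodMkLeft_apply, h, integral_zero]

/-- A strong law of large numbers along the observations, for functions dominated by the envelope
of the log-likelihood ratios. -/
theorem ae_law_tendsto_average (D : DecisionProblem A Θ Y) (μ₀ : ProbabilityMeasure Θ)
    (φ : ℕ → Kernel (ProbabilityMeasure Θ) A) [∀ t, IsMarkovKernel (φ t)]
    {f : A → Y → ℝ} (hf : Measurable fun x : A × Y => f x.1 x.2)
    (hfM : ∀ a y, D.IsRegular y → |f a y| ≤ 2 * Real.log (D.M y)) :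
    ∀ᵐ ω ∂D.law μ₀ φ, Tendsto (fun n : ℕ => (∑ i ∈ Finset.range n,
      (f (ω i).1 (ω i).2 - ∫ y, f (ω i).1 y ∂D.Q (ω i).1)) / n) atTop (𝓝 0) := by
  obtain ⟨C, hC⟩ : ∃ C : ℝ≥0, (C : ℝ≥0∞) = 16 * ∫⁻ y, (D.M y : ℝ≥0∞) * D.r y ∂D.ν :=
    WithTop.ne_top_iff_exists.1 (ENNReal.mul_ne_top (by norm_num) D.lintegral_M_r.ne)
  have hfa : ∀ a, Measurable (f a) := fun a => hf.comp (measurable_const.prodMk measurable_id)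
  have hG : Measurable fun x : A × Y => f x.1 x.2 - ∫ y, f x.1 y ∂D.Q x.1 :=
    hf.sub ((StronglyMeasurable.integral_kernel_prod_right (κ := D.Q) (f := f)
      hf.stronglyMeasurable).measurable.comp measurable_fst)
  -- The bound and the zero mean hold conditionally on each action, so the selection rule and the
  -- belief play no role.
  have h2 : ∀ t μ, ∫⁻ x, ENNReal.ofReal ((f x.1 x.2 - ∫ y, f x.1 y ∂D.Q x.1) ^ 2)
      ∂D.stepKernel (φ t) μ ≤ C := fun t μ =>
    D.lintegral_stepKernel_le (φ t) μ (hG.pow_const 2).ennreal_ofReal fun a => by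
      rw [hC]
      exact D.lintegral_sub_integral_sq_Q_le (hfa a) a (hfM a)
  have h0 : ∀ t μ, ∫ x, (f x.1 x.2 - ∫ y, f x.1 y ∂D.Q x.1) ∂D.stepKernel (φ t) μ = 0 :=
    fun t μ => D.integral_stepKernel_eq_zero (φ t) μ hG (h2 t μ) fun a => by
      simp only
      rw [integral_sub ((D.memLp_two_Q (hfa a) a (hfM a)).integrable one_le_two)
        (integrable_const _)]
      simp
  have := ae_trajMeasure_tendsto_average (ρ := D.stepKernel (φ 0) μ₀) (κ := D.transition μ₀ φ)
    hG (h2 0 μ₀) (fun n h => h2 (n + 1) (D.posterior μ₀ n h))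
    fun n h => h0 (n + 1) (D.posterior μ₀ n h)
  exact this

/-! ### Beliefs along a trajectory and optimality of play -/

/-- The belief held at the beginning of period `n` along the sequence of observations `ω`. -/
noncomputable def belief (D : DecisionProblem A Θ Y) (μ₀ : ProbabilityMeasure Θ)
    (ω : ℕ → A × Y) : ℕ → ProbabilityMeasure Θ
  | 0 => μ₀
  | n + 1 => D.update (belief D μ₀ ω n) (ω n)

/-- Index shift: `posterior` counts the last observation used, `belief` the period about to start.
-/
lemma posterior_frestrictLe (D : DecisionProblem A Θ Y) (μ₀ : ProbabilityMeasure Θ)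
    (ω : ℕ → A × Y) (n : ℕ) :
    D.posterior μ₀ n (Preorder.frestrictLe n ω) = D.belief μ₀ ω (n + 1) := by
  induction n with
  | zero => rw [posterior, belief, belief]; rfl
  | succ n ih =>
    rw [posterior, belief, ← ih]
    rfl

lemma continuous_integral_U (D : DecisionProblem A Θ Y) (μ : ProbabilityMeasure Θ) :
    Continuous fun a => ∫ θ, D.U a θ ∂(μ : Measure Θ) := by
  obtain ⟨C, hC⟩ := isCompact_univ.exists_bound_of_continuousOn
    (D.continuous_U.continuousOn (s := Set.univ))
  refine continuous_of_dominated (bound := fun _ => C) (fun a => ?_)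
    (fun a => ae_of_all _ fun θ => hC (a, θ) trivial) (integrable_const C)
    (ae_of_all _ fun θ => D.continuous_U.comp (continuous_id.prodMk continuous_const))
  exact (D.continuous_U.comp (continuous_const.prodMk continuous_id)).aestronglyMeasurable

/-- Expected payoff is continuous in the action, so optimality need only be tested against a
countable dense set of actions. -/
lemma measurableSet_F (D : DecisionProblem A Θ Y) :
    MeasurableSet {p : ProbabilityMeasure Θ × A | p.2 ∈ D.F p.1} := by
  have heq : {p : ProbabilityMeasure Θ × A | p.2 ∈ D.F p.1} =
      ⋂ n, {p | ∫ θ, D.U (TopologicalSpace.denseSeq A n) θ ∂(p.1 : Measure Θ) ≤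
        ∫ θ, D.U p.2 θ ∂(p.1 : Measure Θ)} := by
    ext p
    simp only [Set.mem_iInter]
    refine ⟨fun h n => h _, fun h b => ?_⟩
    exact (TopologicalSpace.denseRange_denseSeq A).induction_on
      (p := fun b => ∫ θ, D.U b θ ∂(p.1 : Measure Θ) ≤ ∫ θ, D.U p.2 θ ∂(p.1 : Measure Θ)) b
      (isClosed_le (D.continuous_integral_U p.1) continuous_const) h
  let κ : Kernel (ProbabilityMeasure Θ × A) Θ :=
    ⟨fun p => (p.1 : Measure Θ), measurable_subtype_coe.comp measurable_fst⟩
  have : IsMarkovKernel κ := ⟨fun p => inferInstanceAs (IsProbabilityMeasure (p.1 : Measure Θ))⟩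
  have hmeas : ∀ g : ProbabilityMeasure Θ × A → A, Measurable g →
      Measurable fun p => ∫ θ, D.U (g p) θ ∂(p.1 : Measure Θ) := fun g hg =>
    (StronglyMeasurable.integral_kernel_prod_right (κ := κ) (f := fun p θ => D.U (g p) θ)
      (D.continuous_U.measurable.comp
        ((hg.comp measurable_fst).prodMk measurable_snd)).stronglyMeasurable).measurable
  rw [heq]
  exact MeasurableSet.iInter fun n =>
    measurableSet_le (hmeas _ measurable_const) (hmeas _ measurable_snd)

lemma ae_law_mem_F (D : DecisionProblem A Θ Y) (μ₀ : ProbabilityMeasure Θ)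
    (φ : ℕ → Kernel (ProbabilityMeasure Θ) A) [∀ t, IsMarkovKernel (φ t)]
    (hφ : ∀ t μ, φ t μ (D.F μ) = 1) :
    ∀ᵐ ω ∂D.law μ₀ φ, ∀ t, (ω t).1 ∈ D.F (D.belief μ₀ ω t) := by
  have hFm : ∀ μ, MeasurableSet (D.F μ) := fun μ =>
    (measurable_const.prodMk measurable_id : Measurable fun a : A => (μ, a)) D.measurableSet_F
  have hstep : ∀ t μ, ∀ᵐ x ∂D.stepKernel (φ t) μ, x ∈ {x : A × Y | x.1 ∈ D.F μ} := fun t μ => by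
    refine D.ae_stepKernel (φ t) μ (measurable_fst (hFm μ)) ?_
    have : ∀ᵐ a ∂φ t μ, a ∈ D.F μ := (mem_ae_iff_prob_eq_one (hFm μ)).2 (hφ t μ)
    filter_upwards [this] with a ha
    exact ae_of_all _ fun _ => ha
  refine ae_all_iff.2 fun t => ?_
  cases t with
  | zero =>
    exact ae_trajMeasure_zero (ρ := D.stepKernel (φ 0) μ₀) (κ := D.transition μ₀ φ)
      (p := fun x => x.1 ∈ D.F μ₀) (hstep 0 μ₀)
  | succ n =>
    have := ae_trajMeasure_succ (ρ := D.stepKernel (φ 0) μ₀) (κ := D.transition μ₀ φ) n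
      (p := fun z => z.2.1 ∈ D.F (D.posterior μ₀ n z.1))
      ((((D.measurable_posterior μ₀ n).comp measurable_fst).prodMk
        (measurable_fst.comp measurable_snd)) D.measurableSet_F)
      fun h => hstep (n + 1) (D.posterior μ₀ n h)
    filter_upwards [this] with ω hω
    rwa [posterior_frestrictLe] at hω

/-- The likelihood lies between q/M and q M for every parameter, hence so does its average. The
fallback branch of `update` is therefore never taken along regular observations. -/
lemma IsRegular.evidence_ne {D : DecisionProblem A Θ Y} {x : A × Y} (hy : D.IsRegular x.2)
    (hq : D.q x.1 x.2 ≠ 0) (μ : ProbabilityMeasure Θ) :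
    D.evidence μ x ≠ 0 ∧ D.evidence μ x ≠ ∞ := by
  have hM : 0 < D.M x.2 := zero_lt_one.trans_le (D.one_le_M _)
  constructor
  · have hlow : ((D.q x.1 x.2 / D.M x.2 : ℝ≥0) : ℝ≥0∞) ≤ D.evidence μ x := by
      calc ((D.q x.1 x.2 / D.M x.2 : ℝ≥0) : ℝ≥0∞)
          = ∫⁻ _, ((D.q x.1 x.2 / D.M x.2 : ℝ≥0) : ℝ≥0∞) ∂(μ : Measure Θ) := by simp
        _ ≤ D.evidence μ x := lintegral_mono fun θ => by
            rw [ENNReal.coe_le_coe, div_le_iff₀ hM]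
            exact hy.q_le θ x.1
    refine (lt_of_lt_of_le ?_ hlow).ne'
    exact_mod_cast div_pos (pos_iff_ne_zero.2 hq) hM
  · refine ne_top_of_le_ne_top (b := ((D.q x.1 x.2 * D.M x.2 : ℝ≥0) : ℝ≥0∞)) ENNReal.coe_ne_top ?_
    calc D.evidence μ x ≤ ∫⁻ _, ((D.q x.1 x.2 * D.M x.2 : ℝ≥0) : ℝ≥0∞) ∂(μ : Measure Θ) :=
          lintegral_mono fun θ => ENNReal.coe_le_coe.2 (hy.qm_le θ x.1)
      _ = _ := by simp

/-- The belief has a density proportional to the likelihood with respect to the prior. -/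
lemma exists_belief_eq_smul_withDensity (D : DecisionProblem A Θ Y) (μ₀ : ProbabilityMeasure Θ)
    {ω : ℕ → A × Y} (hω : ∀ t, D.IsRegular (ω t).2 ∧ D.q (ω t).1 (ω t).2 ≠ 0) (n : ℕ) :
    ∃ c : ℝ≥0∞, (D.belief μ₀ ω n : Measure Θ) = c • (μ₀ : Measure Θ).withDensity
      fun θ => ∏ i ∈ Finset.range n, (D.qm θ (ω i).1 (ω i).2 : ℝ≥0∞) := by
  have hm : ∀ i, Measurable fun θ => (D.qm θ (ω i).1 (ω i).2 : ℝ≥0∞) := fun i =>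
    (D.measurable_qm.comp (measurable_id.prodMk measurable_const)).coe_nnreal_ennreal
  induction n with
  | zero => exact ⟨1, by simp [belief, withDensity_one, ← Pi.one_def]⟩
  | succ n ih =>
    obtain ⟨c, hc⟩ := ih
    have hE := (hω n).1.evidence_ne (hω n).2 (D.belief μ₀ ω n)
    refine ⟨(D.evidence (D.belief μ₀ ω n) (ω n))⁻¹ * c, ?_⟩
    have h1 : (D.belief μ₀ ω (n + 1) : Measure Θ) = D.bayesMeasure (D.belief μ₀ ω n) (ω n) := by
      rw [belief, update, dif_pos hE]
      rfl
    rw [h1, bayesMeasure, hc, withDensity_smul_measure, smul_smul, ← withDensity_mul _ _ (hm n)]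
    · congr 2
      funext θ
      rw [Pi.mul_apply, Finset.prod_range_succ]
    · exact Finset.measurable_prod _ fun i _ => hm i

/-- Each factor is q_θ = q exp(-llr_θ). The product of the q does not depend on θ, so it is
irrelevant when masses of parameter sets are compared. -/
lemma prod_qm_eq (D : DecisionProblem A Θ Y)
    {ω : ℕ → A × Y} (hω : ∀ t, D.IsRegular (ω t).2 ∧ D.q (ω t).1 (ω t).2 ≠ 0) (n : ℕ) (θ : Θ) :
    ∏ i ∈ Finset.range n, (D.qm θ (ω i).1 (ω i).2 : ℝ≥0∞) =
      (∏ i ∈ Finset.range n, (D.q (ω i).1 (ω i).2 : ℝ≥0∞)) *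
        ENNReal.ofReal (Real.exp (-∑ i ∈ Finset.range n, D.llr θ (ω i).1 (ω i).2)) := by
  rw [← Finset.sum_neg_distrib, Real.exp_sum,
    ENNReal.ofReal_prod_of_nonneg fun i _ => (Real.exp_pos _).le, ← Finset.prod_mul_distrib]
  refine Finset.prod_congr rfl fun i _ => ?_
  have hq : (0 : ℝ) < D.q (ω i).1 (ω i).2 := by
    exact_mod_cast pos_iff_ne_zero.2 (hω i).2
  have hqm : (0 : ℝ) < D.qm θ (ω i).1 (ω i).2 := by
    exact_mod_cast (hω i).1.qm_pos (hω i).2 θ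
  rw [llr, ← Real.log_inv, Real.exp_log (by positivity), inv_div, ← ENNReal.ofReal_coe_nnreal,
    ← ENNReal.ofReal_coe_nnreal (p := D.q (ω i).1 (ω i).2), ← ENNReal.ofReal_mul hq.le]
  congr 1
  field_simp

end Law

/-! ### Concentration of beliefs and passage to the limit -/

section Concentration

set_option linter.unusedSectionVars false

variable {A Θ Y : Type*} [MetricSpace A] [CompactSpace A] [SecondCountableTopology A]
  [Nonempty A] [MeasurableSpace A] [BorelSpace A]
  [MetricSpace Θ] [CompactSpace Θ] [SecondCountableTopology Θ] [Nonempty Θ]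
  [MeasurableSpace Θ] [BorelSpace Θ] [MeasurableSpace Y]

/-- The sequences of observations along which the consequences are regular and the strong law of
large numbers holds for the log-likelihood ratios and their moduli of continuity. -/
structure IsTypical (D : DecisionProblem A Θ Y) (ω : ℕ → A × Y) : Prop where
  regular : ∀ t, D.IsRegular (ω t).2 ∧ D.q (ω t).1 (ω t).2 ≠ 0
  llr : ∀ j, Tendsto (fun n : ℕ => (∑ i ∈ Finset.range n,
    (D.llr (TopologicalSpace.denseSeq Θ j) (ω i).1 (ω i).2 -
      D.K (TopologicalSpace.denseSeq Θ j) (ω i).1)) / n) atTop (𝓝 0)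
  modulus : ∀ N, Tendsto (fun n : ℕ => (∑ i ∈ Finset.range n,
    (D.modulus N (ω i).1 (ω i).2 - ∫ y, D.modulus N (ω i).1 y ∂D.Q (ω i).1)) / n) atTop (𝓝 0)

lemma ae_law_isTypical (D : DecisionProblem A Θ Y) (μ₀ : ProbabilityMeasure Θ)
    (φ : ℕ → Kernel (ProbabilityMeasure Θ) A) [∀ t, IsMarkovKernel (φ t)] :
    ∀ᵐ ω ∂D.law μ₀ φ, D.IsTypical ω := by
  have h1 : ∀ᵐ ω ∂D.law μ₀ φ, ∀ j, Tendsto (fun n : ℕ => (∑ i ∈ Finset.range n,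
      (D.llr (TopologicalSpace.denseSeq Θ j) (ω i).1 (ω i).2 -
        D.K (TopologicalSpace.denseSeq Θ j) (ω i).1)) / n) atTop (𝓝 0) := by
    refine ae_all_iff.2 fun j => ?_
    simp only [K_eq]
    exact D.ae_law_tendsto_average μ₀ φ (D.measurable_llr _) fun a y hy =>
      (hy.abs_llr_le _ a).trans (by linarith [D.log_M_nonneg y])
  have h2 : ∀ᵐ ω ∂D.law μ₀ φ, ∀ N, Tendsto (fun n : ℕ => (∑ i ∈ Finset.range n,
      (D.modulus N (ω i).1 (ω i).2 - ∫ y, D.modulus N (ω i).1 y ∂D.Q (ω i).1)) / n) atTop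
      (𝓝 0) :=
    ae_all_iff.2 fun N => D.ae_law_tendsto_average μ₀ φ (D.measurable_modulus N) fun a y hy => by
      rw [abs_of_nonneg (D.modulus_nonneg _ _ _)]
      exact hy.modulus_le_log N a
  filter_upwards [D.ae_law_isRegular μ₀ φ, h1, h2] with ω h h1 h2 using ⟨h, h1, h2⟩

/-- A locally uniform law of large numbers. Near θ₀ pick a dense parameter d. Moving from θ to d
costs the averaged modulus (ε/2), the strong law at d costs ε/4, and moving the divergence from d to
θ₀ costs ε/4. -/
lemma IsTypical.exists_isOpen_abs_sum_llr_le {D : DecisionProblem A Θ Y} {ω : ℕ → A × Y}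
    (hω : D.IsTypical ω) {a : A} (ha : Tendsto (fun t => (ω t).1) atTop (𝓝 a)) (θ₀ : Θ)
    {ε : ℝ} (hε : 0 < ε) :
    ∃ V : Set Θ, IsOpen V ∧ θ₀ ∈ V ∧ ∀ᶠ n : ℕ in atTop, ∀ θ ∈ V,
      |∑ i ∈ Finset.range n, D.llr θ (ω i).1 (ω i).2 - n * D.K θ₀ a| ≤ n * ε := by
  obtain ⟨N, hN⟩ := D.exists_integral_modulus_le (ε := ε / 4) (by linarith)
  have hKθ : Continuous fun θ => D.K θ a :=
    D.continuous_K.comp (continuous_id.prodMk continuous_const)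
  obtain ⟨j, hj1, hj2⟩ : ∃ j, dist (TopologicalSpace.denseSeq Θ j) θ₀ < 1 / ((N : ℝ) + 1) / 2 ∧
      |D.K (TopologicalSpace.denseSeq Θ j) a - D.K θ₀ a| < ε / 4 := by
    have ho : IsOpen ({θ | dist θ θ₀ < 1 / ((N : ℝ) + 1) / 2} ∩
        {θ | |D.K θ a - D.K θ₀ a| < ε / 4}) :=
      (isOpen_lt (continuous_id.dist continuous_const) continuous_const).inter
        (isOpen_lt (hKθ.sub continuous_const).abs continuous_const)
    exact (TopologicalSpace.denseRange_denseSeq Θ).exists_mem_open ho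
      ⟨θ₀, by simpa using Nat.cast_add_one_pos N, by simpa using hε⟩
  set d := TopologicalSpace.denseSeq Θ j with hd
  have hKa : Tendsto (fun i => D.K d (ω i).1) atTop (𝓝 (D.K d a)) :=
    ((D.continuous_K.comp (continuous_const.prodMk continuous_id)).tendsto a).comp ha
  have havg : Tendsto (fun n : ℕ => (∑ i ∈ Finset.range n, D.llr d (ω i).1 (ω i).2) / n) atTop
      (𝓝 (D.K d a)) := by
    -- The strong law centres at K(d, a_i); these converge to K(d, a), hence so do their averages.
    have h := (hω.llr j).add hKa.cesaro
    rw [zero_add] at h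
    refine h.congr fun n => ?_
    rw [Finset.sum_sub_distrib, ← hd]
    ring
  -- Half the scale: any θ in this ball and d are then within 1/(N+1) of each other.
  refine ⟨Metric.ball θ₀ (1 / ((N : ℝ) + 1) / 2), Metric.isOpen_ball,
    Metric.mem_ball_self (by positivity), ?_⟩
  filter_upwards [Metric.tendsto_nhds.1 havg (ε / 4) (by linarith),
    Metric.tendsto_nhds.1 (hω.modulus N) (ε / 4) (by linarith), eventually_gt_atTop 0]
    with n hn1 hn2 hn θ hθ
  have hnR : (0 : ℝ) < n := by exact_mod_cast hn
  have hθd : dist θ d < 1 / ((N : ℝ) + 1) := by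
    have := dist_triangle_right θ d θ₀
    rw [Metric.mem_ball] at hθ
    linarith
  have e1 : |∑ i ∈ Finset.range n, D.llr θ (ω i).1 (ω i).2 -
      ∑ i ∈ Finset.range n, D.llr d (ω i).1 (ω i).2| ≤
      ∑ i ∈ Finset.range n, D.modulus N (ω i).1 (ω i).2 := by
    rw [← Finset.sum_sub_distrib]
    exact (Finset.abs_sum_le_sum_abs _ _).trans (Finset.sum_le_sum fun i _ =>
      (hω.regular i).1.abs_llr_sub_le_modulus (hω.regular i).2 hθd)
  have e2 : ∑ i ∈ Finset.range n, D.modulus N (ω i).1 (ω i).2 ≤ n * (ε / 2) := by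
    have h1 : ∑ i ∈ Finset.range n, ∫ y, D.modulus N (ω i).1 y ∂D.Q (ω i).1 ≤ n * (ε / 4) := by
      refine (Finset.sum_le_sum fun i _ => hN (ω i).1).trans_eq ?_
      simp
    rw [Real.dist_eq, sub_zero] at hn2
    have h2 := (abs_lt.1 hn2).2
    rw [div_lt_iff₀ hnR, Finset.sum_sub_distrib] at h2
    linarith
  have e3 : |∑ i ∈ Finset.range n, D.llr d (ω i).1 (ω i).2 - n * D.K d a| ≤ n * (ε / 4) := by
    rw [Real.dist_eq] at hn1
    have : ∑ i ∈ Finset.range n, D.llr d (ω i).1 (ω i).2 - n * D.K d a =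
        n * ((∑ i ∈ Finset.range n, D.llr d (ω i).1 (ω i).2) / n - D.K d a) := by
      field_simp
    rw [this, abs_mul, abs_of_pos hnR]
    gcongr
  have e4 : |n * D.K d a - n * D.K θ₀ a| ≤ n * (ε / 4) := by
    rw [← mul_sub, abs_mul, abs_of_pos hnR]
    gcongr
  rw [abs_le] at *
  constructor <;> linarith [e1.1, e1.2, e3.1, e3.2, e4.1, e4.2]

/-- The belief vanishes near a parameter that does not minimize the divergence at the limit
action. -/
lemma IsTypical.exists_isOpen_tendsto_belief {D : DecisionProblem A Θ Y} {ω : ℕ → A × Y}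
    (hω : D.IsTypical ω) {μ₀ : ProbabilityMeasure Θ} (hμ₀ : (μ₀ : Measure Θ).support = Set.univ)
    {a : A} (ha : Tendsto (fun t => (ω t).1) atTop (𝓝 a)) {θ₁ θ₂ : Θ}
    (hlt : D.K θ₂ a < D.K θ₁ a) :
    ∃ V : Set Θ, IsOpen V ∧ θ₁ ∈ V ∧
      Tendsto (fun n => (D.belief μ₀ ω n : Measure Θ) V) atTop (𝓝 0) := by
  -- With a quarter of the gap, the sums are at least n(K(θ₂, a) + 3ε) on V₁ and at most n(K(θ₂, a)
  -- + ε) on V₂, leaving a rate of 2ε.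
  set ε := (D.K θ₁ a - D.K θ₂ a) / 4 with hε
  have hεpos : 0 < ε := by rw [hε]; linarith
  obtain ⟨V₁, hV₁, hθ₁, h₁⟩ := hω.exists_isOpen_abs_sum_llr_le ha θ₁ hεpos
  obtain ⟨V₂, hV₂, hθ₂, h₂⟩ := hω.exists_isOpen_abs_sum_llr_le ha θ₂ hεpos
  refine ⟨V₁, hV₁, hθ₁, ?_⟩
  have hpos : 0 < (μ₀ : Measure Θ) V₂ :=
    (Measure.mem_support_iff_forall θ₂).1 (hμ₀ ▸ Set.mem_univ θ₂) V₂ (hV₂.mem_nhds hθ₂)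
  have hlim : Tendsto (fun n : ℕ => ENNReal.ofReal (Real.exp (-(n * (2 * ε)))) /
      (μ₀ : Measure Θ) V₂) atTop (𝓝 0) := by
    have h1 : Tendsto (fun n : ℕ => Real.exp (-(n * (2 * ε)))) atTop (𝓝 0) :=
      Real.tendsto_exp_neg_atTop_nhds_zero.comp
        (tendsto_natCast_atTop_atTop.atTop_mul_const (by linarith))
    have h2 := ENNReal.Tendsto.div_const (ENNReal.tendsto_ofReal h1)
      (b := (μ₀ : Measure Θ) V₂) (Or.inr hpos.ne')
    simpa using h2
  refine tendsto_of_tendsto_of_tendsto_of_le_of_le' tendsto_const_nhds hlim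
    (Eventually.of_forall fun _ => zero_le) ?_
  filter_upwards [h₁, h₂] with n hn₁ hn₂
  obtain ⟨c, hc⟩ := D.exists_belief_eq_smul_withDensity μ₀ hω.regular n
  set q := ∏ i ∈ Finset.range n, (D.q (ω i).1 (ω i).2 : ℝ≥0∞)
  have hb : ∀ V : Set Θ, IsOpen V → (D.belief μ₀ ω n : Measure Θ) V = c * ∫⁻ θ in V,
      q * ENNReal.ofReal (Real.exp (-∑ i ∈ Finset.range n, D.llr θ (ω i).1 (ω i).2))
        ∂(μ₀ : Measure Θ) := fun V hV => by
    rw [hc, Measure.smul_apply, smul_eq_mul, withDensity_apply _ hV.measurableSet]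
    simp only [D.prod_qm_eq hω.regular, q]
  set u := ENNReal.ofReal (Real.exp (-(n * (D.K θ₂ a + ε))))
  have hup : (D.belief μ₀ ω n : Measure Θ) V₁ ≤
      ENNReal.ofReal (Real.exp (-(n * (2 * ε)))) * (c * (q * u)) := by
    rw [hb V₁ hV₁]
    calc c * ∫⁻ θ in V₁, q * ENNReal.ofReal (Real.exp
            (-∑ i ∈ Finset.range n, D.llr θ (ω i).1 (ω i).2)) ∂(μ₀ : Measure Θ)
        ≤ c * ∫⁻ _ in V₁, q * (ENNReal.ofReal (Real.exp (-(n * (2 * ε)))) * u)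
            ∂(μ₀ : Measure Θ) := by
          gcongr c * ?_
          refine setLIntegral_mono measurable_const fun θ hθ => ?_
          gcongr q * ?_
          rw [← ENNReal.ofReal_mul (Real.exp_pos _).le, ← Real.exp_add]
          refine ENNReal.ofReal_le_ofReal (Real.exp_le_exp.2 ?_)
          have h1 := (abs_le.1 (hn₁ θ hθ)).1
          have h2 : D.K θ₁ a = D.K θ₂ a + 4 * ε := by rw [hε]; ring
          rw [h2] at h1
          linarith
      _ ≤ c * (q * (ENNReal.ofReal (Real.exp (-(n * (2 * ε)))) * u)) := by
          rw [setLIntegral_const]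
          gcongr c * ?_
          exact mul_le_of_le_one_right' prob_le_one
      _ = _ := by ring
  -- The normalization c and the factor q are not controlled separately; that the belief gives V₂
  -- mass at most 1 bounds their product with u by 1/μ₀(V₂).
  have hdown : c * (q * u) * (μ₀ : Measure Θ) V₂ ≤ 1 := by
    calc c * (q * u) * (μ₀ : Measure Θ) V₂ = c * ∫⁻ _ in V₂, q * u ∂(μ₀ : Measure Θ) := by
          rw [setLIntegral_const, mul_assoc]
      _ ≤ (D.belief μ₀ ω n : Measure Θ) V₂ := by
          rw [hb V₂ hV₂]
          gcongr c * ?_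
          refine setLIntegral_mono' hV₂.measurableSet fun θ hθ => ?_
          gcongr q * ?_
          refine ENNReal.ofReal_le_ofReal (Real.exp_le_exp.2 ?_)
          have h1 := (abs_le.1 (hn₂ θ hθ)).2
          linarith
      _ ≤ 1 := prob_le_one
  rw [ENNReal.le_div_iff_mul_le (Or.inl hpos.ne') (Or.inl (measure_ne_top _ _))]
  calc (D.belief μ₀ ω n : Measure Θ) V₁ * (μ₀ : Measure Θ) V₂
      ≤ ENNReal.ofReal (Real.exp (-(n * (2 * ε)))) * (c * (q * u)) * (μ₀ : Measure Θ) V₂ := by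
        gcongr
    _ = ENNReal.ofReal (Real.exp (-(n * (2 * ε)))) * (c * (q * u) * (μ₀ : Measure Θ) V₂) := by
        ring
    _ ≤ _ := mul_le_of_le_one_right' hdown

/-- The optimality correspondence has a closed graph, along an arbitrary filter. -/
lemma mem_F_of_tendsto (D : DecisionProblem A Θ Y) {ι : Type*} {l : Filter ι} [l.NeBot]
    {μs : ι → ProbabilityMeasure Θ} {μ : ProbabilityMeasure Θ} (hμ : Tendsto μs l (𝓝 μ))
    {as : ι → A} {a : A} (ha : Tendsto as l (𝓝 a)) (h : ∀ i, as i ∈ D.F (μs i)) :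
    a ∈ D.F μ := by
  have hcont : ∀ b, Continuous (D.U b) := fun b =>
    D.continuous_U.comp (continuous_const.prodMk continuous_id)
  have hint : ∀ b (ρ : ProbabilityMeasure Θ), Integrable (D.U b) (ρ : Measure Θ) := fun b ρ =>
    (hcont b).integrable_of_hasCompactSupport (HasCompactSupport.of_compactSpace _)
  have hlim : ∀ b, Tendsto (fun i => ∫ θ, D.U b θ ∂(μs i : Measure Θ)) l
      (𝓝 (∫ θ, D.U b θ ∂(μ : Measure Θ))) := fun b =>
    ProbabilityMeasure.tendsto_iff_forall_integral_tendsto.1 hμ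
      (BoundedContinuousFunction.mkOfCompact ⟨D.U b, hcont b⟩)
  -- Uniform continuity of `U` makes the cost of replacing the action by its limit small uniformly
  -- in θ, hence under every belief; weak convergence then handles a fixed action.
  have hdiff : Tendsto (fun i => ∫ θ, D.U (as i) θ ∂(μs i : Measure Θ) -
      ∫ θ, D.U a θ ∂(μs i : Measure Θ)) l (𝓝 0) := by
    have huc := CompactSpace.uniformContinuous_of_continuous D.continuous_U
    refine Metric.tendsto_nhds.2 fun ε hε => ?_
    obtain ⟨δ, hδ, hδε⟩ := Metric.uniformContinuous_iff.1 huc (ε / 2) (half_pos hε)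
    filter_upwards [Metric.tendsto_nhds.1 ha δ hδ] with i hi
    rw [Real.dist_eq, sub_zero, ← integral_sub (hint _ _) (hint _ _), ← Real.norm_eq_abs]
    refine lt_of_le_of_lt ?_ (half_lt_self hε)
    have := norm_integral_le_of_norm_le_const (μ := (μs i : Measure Θ)) (C := ε / 2)
      (f := fun θ => D.U (as i) θ - D.U a θ) (ae_of_all _ fun θ => by
        have hd : dist (as i, θ) (a, θ) < δ := by
          rwa [Prod.dist_eq, dist_self, max_eq_left dist_nonneg]
        exact (hδε hd).le)
    simpa using this
  intro b
  have hlim2 := hdiff.add (hlim a)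
  rw [zero_add] at hlim2
  refine le_of_tendsto_of_tendsto (hlim b) hlim2 (Eventually.of_forall fun i => ?_)
  simpa using h i b

lemma minimizers_diracProba (D : DecisionProblem A Θ Y) (a : A) :
    D.minimizers (diracProba a) = {θ | ∀ θ', D.K θ a ≤ D.K θ' a} := by
  simp [minimizers, diracProba]

theorem IsTypical.exists_limit_belief {D : DecisionProblem A Θ Y} {ω : ℕ → A × Y}
    (hω : D.IsTypical ω) {μ₀ : ProbabilityMeasure Θ} (hμ₀ : (μ₀ : Measure Θ).support = Set.univ)
    (hF : ∀ t, (ω t).1 ∈ D.F (D.belief μ₀ ω t))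
    {a : A} (ha : Tendsto (fun t => (ω t).1) atTop (𝓝 a)) :
    ∃ μ : ProbabilityMeasure Θ, (μ : Measure Θ).support ⊆ D.minimizers (diracProba a) ∧
      a ∈ D.F μ := by
  -- A nonprincipal ultrafilter replaces the choice of a convergent subsequence of beliefs.
  obtain ⟨μ, -, hμ⟩ := isCompact_univ.ultrafilter_le_nhds
    ((hyperfilter ℕ).map (D.belief μ₀ ω)) (by simp)
  have hlim : Tendsto (D.belief μ₀ ω) (hyperfilter ℕ : Filter ℕ) (𝓝 μ) := hμ
  have hle : (hyperfilter ℕ : Filter ℕ) ≤ atTop := Nat.hyperfilter_le_atTop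
  refine ⟨μ, fun θ hθ => ?_, D.mem_F_of_tendsto hlim (ha.mono_left hle) hF⟩
  rw [minimizers_diracProba]
  by_contra! hcon
  simp only [Set.mem_ofPred_eq, not_forall, not_le] at hcon
  obtain ⟨θ', hθ'⟩ := hcon
  obtain ⟨V, hV, hθV, hVlim⟩ := hω.exists_isOpen_tendsto_belief hμ₀ ha hθ'
  -- Portmanteau for open sets: the limit gives V at most the limiting mass, which is 0, so θ is not
  -- in its support.
  have h := ProbabilityMeasure.le_liminf_measure_open_of_tendsto hlim hV
  rw [(hVlim.mono_left hle).liminf_eq] at h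
  exact ((Measure.mem_support_iff_forall θ).1 hθ V (hV.mem_nhds hθV)).ne' (le_antisymm h zero_le)

lemma isBerkNash_diracProba (D : DecisionProblem A Θ Y) {a : A} {μ : ProbabilityMeasure Θ}
    (hμ : (μ : Measure Θ).support ⊆ D.minimizers (diracProba a)) (ha : a ∈ D.F μ) :
    D.IsBerkNash (diracProba a) := by
  refine ⟨μ, fun b hb => ?_, hμ⟩
  by_cases hba : b = a
  · exact hba ▸ ha
  · have := (Measure.mem_support_iff_forall b).1 hb {a}ᶜ (isOpen_ne.mem_nhds hba)
    simp [diracProba] at this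

theorem ae_law_isBerkNash_of_tendsto (D : DecisionProblem A Θ Y) {μ₀ : ProbabilityMeasure Θ}
    (hμ₀ : (μ₀ : Measure Θ).support = Set.univ)
    (φ : ℕ → Kernel (ProbabilityMeasure Θ) A) [∀ t, IsMarkovKernel (φ t)]
    (hφ : ∀ t μ, φ t μ (D.F μ) = 1) :
    ∀ᵐ ω ∂D.law μ₀ φ, ∀ a : A, Tendsto (fun t => (ω t).1) atTop (𝓝 a) →
      D.IsBerkNash (diracProba a) ∧ ∃ μ : ProbabilityMeasure Θ,
        (μ : Measure Θ).support ⊆ D.minimizers (diracProba a) ∧ a ∈ D.F μ := by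
  filter_upwards [D.ae_law_isTypical μ₀ φ, D.ae_law_mem_F μ₀ φ hφ] with ω hω hF a ha
  obtain ⟨μ, hμ, haμ⟩ := hω.exists_limit_belief hμ₀ hF ha
  exact ⟨D.isBerkNash_diracProba hμ haμ, μ, hμ, haμ⟩

end Concentration

end DecisionProblem

end BerkNash

theorem mainTheorem4 {k l m : ℕ}
    (𝔸 : Set (EuclideanSpace ℝ (Fin k))) (h𝔸 : IsCompact 𝔸) (h𝔸' : 𝔸.Nonempty)
    (Θ : Set (EuclideanSpace ℝ (Fin l))) (hΘ : IsCompact Θ) (hΘ' : Θ.Nonempty)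
    (𝕐 : Set (EuclideanSpace ℝ (Fin m))) (h𝕐 : MeasurableSet 𝕐)
    (D : BerkNash.DecisionProblem 𝔸 Θ 𝕐)
    (μ₀ : ProbabilityMeasure Θ) (hμ₀ : (μ₀ : Measure Θ).support = Set.univ)
    (φ : ℕ → Kernel (ProbabilityMeasure Θ) 𝔸) [∀ t, IsMarkovKernel (φ t)]
    (hφ : ∀ t μ, φ t μ (D.F μ) = 1) :
    ∀ᵐ ω ∂(D.law μ₀ φ), ∀ aStar : 𝔸,
      Tendsto (fun t => (ω t).1) atTop (𝓝 aStar) →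
        D.IsBerkNash (diracProba aStar) ∧
        ∃ μStar : ProbabilityMeasure Θ,
          (μStar : Measure Θ).support ⊆ D.minimizers (diracProba aStar) ∧ aStar ∈ D.F μStar := by
  have := isCompact_iff_compactSpace.1 h𝔸
  have := isCompact_iff_compactSpace.1 hΘ
  have := h𝔸'.to_subtype
  have := hΘ'.to_subtype
  exact D.ae_law_isBerkNash_of_tendsto hμ₀ φ hφ
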